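/- Let $\Omega\subset\mathbb R^N$ be a bounded open set (for instance a smooth bounded domain). **Assumptions on $j$ and $g$.** Let $j:\Omega\times\mathbb R\times\mathbb R^N\to\mathbb R$ be such that $j(\cdot,s,\xi)$ is measurable for all $(s,\xi)$, $j(x,\cdot,\cdot)$ is of class $C^1$ for a.e. $x\in\Omega$, $\xi\mapsto j(x,s,\xi)$ is strictly convex for a.e. $x$ and all $s$, and there are continuous $\alpha,\gamma,\mu:[0,\infty)\to[0,\infty)$ with $\alpha\ge 1$ and $$\tfrac1{\alpha(|s|)}|\xi|^2\le j(x,s,\xi)\le\alpha(|s|)|\xi|^2,\qquad |j_s(x,s,\xi)|\le\gamma(|s|)|\xi|^2,\qquad |j_\xi(x,s,\xi)|\le\mu(|s|)|\xi|$$ for a.e. $x\in\Omega$ and all $(s,\xi)\in\mathbb R\times\mathbb R^N$. Let $g:\Omega\times\mathbb R\to\mathbb R$ be a Carathéodory function with $\sup_{|t|\le r}|g(\cdot,t)|\in L^1(\Omega)$ for every $r\ge0$. **Change of variable.** Let $\varphi:\mathbb R\to\mathbb R$ be an odd diffeomorphism of class $C^2$ with $\varphi(0)=0$ such that $\varphi'(s)\ge\sigma\sqrt{\alpha(|\varphi(s)|)}$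 for all $s\in\mathbb R$ and some $\sigma>0$, and $$\lim_{s\to+\infty}\frac{s\varphi'(s)}{\varphi(s)}=1+\lim_{s\to+\infty}\frac{s\varphi''(s)}{\varphi'(s)}=\frac1{1-\beta}\quad\text{for some }\beta\in[0,1).$$ Set $j^\sharp(x,s,\xi)=j(x,\varphi(s),\varphi'(s)\xi)$ and $g^\sharp(x,s)=g(x,\varphi(s))\varphi'(s)$. **Generalized solutions.** For $k>0$ let $T_k(s)=\max\{-k,\min\{s,k\}\}$. If $u$ is measurable on $\Omega$, finite a.e., with $T_k(u)\in H^1_0(\Omega)$ for all $k>0$, then $\nabla u$ denotes the a.e. unique measurable field $\omega:\Omega\to\mathbb R^N$ such that $\nabla T_k(u)=\omega\chi_{\{|u|\le k\}}$ a.e. in $\Omega$ for all $k>0$. Let $$V_u=\{w\in H^1_0(\Omega)\cap L^\infty(\Omega):\ u\in L^\infty(\{w\ne0\})\}.$$ A function $u$ is a *generalized solution* of $$-\operatorname{div}(j_\xi(x,u,\nabla u))+j_s(x,u,\nabla u)=g(x,u)\ \text{ in }\Omega,\qquad u=0\ \text{ on }\partial\Omega,\tag{P}$$ if $u$ is measurable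 and finite a.e., $T_k(u)\in H^1_0(\Omega)$ for all $k>0$, $j_\xi(x,u,\nabla u)\cdot\nabla u\in L^1(\Omega)$, $j_s(x,u,\nabla u)u\in L^1(\Omega)$, and $$\int_\Omega j_\xi(x,u,\nabla u)\cdot\nabla w+\int_\Omega j_s(x,u,\nabla u)w=\int_\Omega g(x,u)w\qquad\text{for all }w\in V_u.$$ Generalized solutions of the problem $(\mathrm P^\sharp)$, obtained from (P) by replacing $j,g$ with $j^\sharp,g^\sharp$, are defined in the same way. **Proposition.** If $v$ is a generalized solution of $(\mathrm P^\sharp)$, then $u=\varphi(v)$ is a generalized solution of (P). If in addition $v\in H^1_0(\Omega)\cap L^\infty(\Omega)$, then $u\in H^1_0(\Omega)\cap L^\infty(\Omega)$ and $u$ is a distributional solution of (P): $j_\xi(x,u,\nabla u)$, $j_s(x,u,\nabla u)$ and $g(x,u)$ are in $L^1_{\rm loc}(\Omega)$, with $\nabla u$ the weak gradient, and $$\int_\Omega j_\xi(x,u,\nabla u)\cdot\nabla\psi+\int_\Omega j_s(x,u,\nabla u)\psi=\int_\Omega g(x,u)\psi\qquad\text{for all }\psi\in C_c^\infty(\Omega).$$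 -/

import Mathlib

open MeasureTheory Filter Topology
open scoped ContDiff Manifold

noncomputable section

namespace QuasiLinear

/-! ### The Sobolev space `H¹₀(Ω)` and gradients

Functions on `Ω` are functions on the whole space, considered only up to equality almost everywhere
with respect to Lebesgue measure restricted to `Ω`. -/

/-- `ψ ∈ C_c^∞(Ω)`. -/
def IsTestFunction {N : ℕ} (Ω : Set (EuclideanSpace ℝ (Fin N)))
    (ψ : EuclideanSpace ℝ (Fin N) → ℝ) : Prop :=
  ContDiff ℝ ∞ ψ ∧ HasCompactSupport ψ ∧ tsupport ψ ⊆ Ω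

/-- `G` is the gradient of `u` in `Ω` in the sense of distributions, both being in `L¹_loc(Ω)`. -/
def HasWeakGradient {N : ℕ} (Ω : Set (EuclideanSpace ℝ (Fin N)))
    (u : EuclideanSpace ℝ (Fin N) → ℝ)
    (G : EuclideanSpace ℝ (Fin N) → EuclideanSpace ℝ (Fin N)) : Prop :=
  LocallyIntegrableOn u Ω ∧ LocallyIntegrableOn G Ω ∧
    ∀ ψ, IsTestFunction Ω ψ →
      ∫ x in Ω, u x • gradient ψ x = - ∫ x in Ω, ψ x • G x

/-- `u ∈ H¹₀(Ω)` with `∇u = G`: `u` belongs to `H¹(Ω)`, its weak gradient is `G`, and `u` is the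
limit in the norm of `H¹(Ω)` of a sequence in `C_c^∞(Ω)`. -/
def MemH10With {N : ℕ} (Ω : Set (EuclideanSpace ℝ (Fin N)))
    (u : EuclideanSpace ℝ (Fin N) → ℝ)
    (G : EuclideanSpace ℝ (Fin N) → EuclideanSpace ℝ (Fin N)) : Prop :=
  MemLp u 2 (volume.restrict Ω) ∧ MemLp G 2 (volume.restrict Ω) ∧ HasWeakGradient Ω u G ∧
    ∃ ψ : ℕ → EuclideanSpace ℝ (Fin N) → ℝ, (∀ n, IsTestFunction Ω (ψ n)) ∧
      Tendsto (fun n => eLpNorm (fun x => ψ n x - u x) 2 (volume.restrict Ω)) atTop (𝓝 0) ∧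
      Tendsto (fun n => eLpNorm (fun x => gradient (ψ n) x - G x) 2 (volume.restrict Ω))
        atTop (𝓝 0)

/-- `u ∈ H¹₀(Ω)`. -/
def MemH10 {N : ℕ} (Ω : Set (EuclideanSpace ℝ (Fin N)))
    (u : EuclideanSpace ℝ (Fin N) → ℝ) : Prop :=
  ∃ G, MemH10With Ω u G

/-- `u ∈ L^∞(Ω)`. -/
def MemLinfty {N : ℕ} (Ω : Set (EuclideanSpace ℝ (Fin N)))
    (u : EuclideanSpace ℝ (Fin N) → ℝ) : Prop :=
  MemLp u ⊤ (volume.restrict Ω)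

/-- The truncation `T_k` at level `k > 0`: `T_k(s) = s` if `|s| ≤ k` and `T_k(s) = k sign(s)` if
`|s| ≥ k`. -/
def trunc (k s : ℝ) : ℝ := max (-k) (min s k)

/-- The measurable field `F` satisfies `∇T_k(u) = F χ_{|u| ≤ k}` a.e. in `Ω`, for all `k > 0`,
where `T_k(u) ∈ H¹₀(Ω)`. -/
def IsGenGradient {N : ℕ} (Ω : Set (EuclideanSpace ℝ (Fin N)))
    (u : EuclideanSpace ℝ (Fin N) → ℝ)
    (F : EuclideanSpace ℝ (Fin N) → EuclideanSpace ℝ (Fin N)) : Prop :=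
  AEMeasurable F (volume.restrict Ω) ∧
    ∀ k : ℝ, 0 < k →
      MemH10With Ω (fun x => trunc k (u x)) (Set.indicator {x | |u x| ≤ k} F)

open Classical in
/-- The generalized gradient `∇u` of a measurable function all of whose truncations are in
`H¹₀(Ω)`; for such functions the field in `IsGenGradient` exists and is unique up to equality
almost everywhere in `Ω`. (The value is irrelevant for other functions.) -/
def genGradient {N : ℕ} (Ω : Set (EuclideanSpace ℝ (Fin N)))
    (u : EuclideanSpace ℝ (Fin N) → ℝ) :
    EuclideanSpace ℝ (Fin N) → EuclideanSpace ℝ (Fin N) :=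
  if h : ∃ F, IsGenGradient Ω u F then h.choose else 0

/-! ### The integrand `j` and the nonlinearity `g` -/

/-- The partial derivative `j_s`. -/
def partialS {N : ℕ} (j : EuclideanSpace ℝ (Fin N) → ℝ → EuclideanSpace ℝ (Fin N) → ℝ)
    (x : EuclideanSpace ℝ (Fin N)) (s : ℝ) (ξ : EuclideanSpace ℝ (Fin N)) : ℝ :=
  deriv (fun t => j x t ξ) s

/-- The partial gradient `j_ξ`. -/
def partialXi {N : ℕ} (j : EuclideanSpace ℝ (Fin N) → ℝ → EuclideanSpace ℝ (Fin N) → ℝ)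
    (x : EuclideanSpace ℝ (Fin N)) (s : ℝ) (ξ : EuclideanSpace ℝ (Fin N)) :
    EuclideanSpace ℝ (Fin N) :=
  gradient (fun η => j x s η) ξ

/-- The standing assumptions on `j`, with growth functions `α, γ, μ : [0,∞) → [0,∞)`
(their values on the negative half-line play no role). -/
structure IsAdmissibleIntegrand {N : ℕ} (Ω : Set (EuclideanSpace ℝ (Fin N)))
    (α γ μ : ℝ → ℝ)
    (j : EuclideanSpace ℝ (Fin N) → ℝ → EuclideanSpace ℝ (Fin N) → ℝ) : Prop where
  measurable : ∀ s ξ, AEMeasurable (fun x => j x s ξ) (volume.restrict Ω)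
  contDiff : ∀ᵐ x ∂volume.restrict Ω,
    ContDiff ℝ 1 (fun p : ℝ × EuclideanSpace ℝ (Fin N) => j x p.1 p.2)
  strictConvex : ∀ᵐ x ∂volume.restrict Ω, ∀ s, StrictConvexOn ℝ Set.univ (j x s)
  continuousOn_α : ContinuousOn α (Set.Ici 0)
  continuousOn_γ : ContinuousOn γ (Set.Ici 0)
  continuousOn_μ : ContinuousOn μ (Set.Ici 0)
  one_le_α : ∀ r, 0 ≤ r → 1 ≤ α r
  nonneg_γ : ∀ r, 0 ≤ r → 0 ≤ γ r
  nonneg_μ : ∀ r, 0 ≤ r → 0 ≤ μ r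
  growth : ∀ᵐ x ∂volume.restrict Ω, ∀ s ξ,
    1 / α |s| * ‖ξ‖ ^ 2 ≤ j x s ξ ∧ j x s ξ ≤ α |s| * ‖ξ‖ ^ 2
  growth_s : ∀ᵐ x ∂volume.restrict Ω, ∀ s ξ, |partialS j x s ξ| ≤ γ |s| * ‖ξ‖ ^ 2
  growth_xi : ∀ᵐ x ∂volume.restrict Ω, ∀ s ξ, ‖partialXi j x s ξ‖ ≤ μ |s| * ‖ξ‖

/-- The standing assumptions on `g`: it is a Carathéodory function and
`sup_{|t| ≤ r} |g(·,t)| ∈ L¹(Ω)` for every `r ≥ 0`. -/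
structure IsAdmissibleNonlinearity {N : ℕ} (Ω : Set (EuclideanSpace ℝ (Fin N)))
    (g : EuclideanSpace ℝ (Fin N) → ℝ → ℝ) : Prop where
  measurable : ∀ t, AEMeasurable (fun x => g x t) (volume.restrict Ω)
  continuous : ∀ᵐ x ∂volume.restrict Ω, Continuous (g x)
  integrable_sup : ∀ r : ℝ, 0 ≤ r →
    IntegrableOn (fun x => sSup ((fun t => |g x t|) '' Set.Icc (-r) r)) Ω

/-! ### The change of variable -/

/-- The class of odd `C²` diffeomorphisms `φ` of the line attached to the growth function `α`. -/
structure IsAdmissibleDiffeo (α : ℝ → ℝ) (φ : ℝ → ℝ) : Prop where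
  diffeo : ∃ Φ : ℝ ≃ₘ^2⟮𝓘(ℝ, ℝ), 𝓘(ℝ, ℝ)⟯ ℝ, ⇑Φ = φ
  odd : ∀ s, φ (-s) = -φ s
  map_zero : φ 0 = 0
  lower_bound : ∃ σ : ℝ, 0 < σ ∧ ∀ s, σ * √(α |φ s|) ≤ deriv φ s
  asymptotic : ∃ β : ℝ, 0 ≤ β ∧ β < 1 ∧
    Tendsto (fun s => s * deriv φ s / φ s) atTop (𝓝 (1 / (1 - β))) ∧
    Tendsto (fun s => 1 + s * deriv (deriv φ) s / deriv φ s) atTop (𝓝 (1 / (1 - β)))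

/-- `j♯(x,s,ξ) = j(x, φ(s), φ'(s)ξ)`. -/
def sharpJ {N : ℕ} (φ : ℝ → ℝ)
    (j : EuclideanSpace ℝ (Fin N) → ℝ → EuclideanSpace ℝ (Fin N) → ℝ) :
    EuclideanSpace ℝ (Fin N) → ℝ → EuclideanSpace ℝ (Fin N) → ℝ :=
  fun x s ξ => j x (φ s) (deriv φ s • ξ)

/-- `g♯(x,s) = g(x, φ(s)) φ'(s)`. -/
def sharpG {N : ℕ} (φ : ℝ → ℝ) (g : EuclideanSpace ℝ (Fin N) → ℝ → ℝ) :
    EuclideanSpace ℝ (Fin N) → ℝ → ℝ :=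
  fun x s => g x (φ s) * deriv φ s

/-! ### Solutions -/

/-- `w ∈ V_u`: `w ∈ H¹₀(Ω) ∩ L^∞(Ω)` and `u` is essentially bounded on `{w ≠ 0}`. -/
def MemV {N : ℕ} (Ω : Set (EuclideanSpace ℝ (Fin N)))
    (u w : EuclideanSpace ℝ (Fin N) → ℝ) : Prop :=
  MemH10 Ω w ∧ MemLinfty Ω w ∧ ∃ C : ℝ, ∀ᵐ x ∂volume.restrict Ω, w x ≠ 0 → |u x| ≤ C

/-- `u` is a generalized solution of `-div(j_ξ(x,u,∇u)) + j_s(x,u,∇u) = g(x,u)` in `Ω`, `u = 0`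
on `∂Ω`. In `identity`, `G` is the weak gradient `∇w`; under the growth assumptions on `j` and `g`
the three integrands there are in `L¹(Ω)` for every `w ∈ V_u`. -/
structure IsGeneralizedSolution {N : ℕ} (Ω : Set (EuclideanSpace ℝ (Fin N)))
    (j : EuclideanSpace ℝ (Fin N) → ℝ → EuclideanSpace ℝ (Fin N) → ℝ)
    (g : EuclideanSpace ℝ (Fin N) → ℝ → ℝ)
    (u : EuclideanSpace ℝ (Fin N) → ℝ) : Prop where
  measurable : AEMeasurable u (volume.restrict Ω)
  truncations : ∀ k : ℝ, 0 < k → MemH10 Ω (fun x => trunc k (u x))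
  integrable_xi : IntegrableOn
    (fun x => inner ℝ (partialXi j x (u x) (genGradient Ω u x)) (genGradient Ω u x)) Ω
  integrable_s : IntegrableOn (fun x => partialS j x (u x) (genGradient Ω u x) * u x) Ω
  identity : ∀ w G, MemV Ω u w → HasWeakGradient Ω w G →
    (∫ x in Ω, inner ℝ (partialXi j x (u x) (genGradient Ω u x)) (G x)) +
      (∫ x in Ω, partialS j x (u x) (genGradient Ω u x) * w x) =
      ∫ x in Ω, g x (u x) * w x

/-- `u` solves `-div(j_ξ(x,u,∇u)) + j_s(x,u,∇u) = g(x,u)` in the sense of distributions in `Ω`: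
`u` has a weak gradient `G = ∇u`, the three terms are in `L¹_loc(Ω)`, and the equation holds
against all test functions. -/
def IsDistributionalSolution {N : ℕ} (Ω : Set (EuclideanSpace ℝ (Fin N)))
    (j : EuclideanSpace ℝ (Fin N) → ℝ → EuclideanSpace ℝ (Fin N) → ℝ)
    (g : EuclideanSpace ℝ (Fin N) → ℝ → ℝ)
    (u : EuclideanSpace ℝ (Fin N) → ℝ) : Prop :=
  ∃ G, HasWeakGradient Ω u G ∧
    LocallyIntegrableOn (fun x => partialXi j x (u x) (G x)) Ω ∧
    LocallyIntegrableOn (fun x => partialS j x (u x) (G x)) Ω ∧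
    LocallyIntegrableOn (fun x => g x (u x)) Ω ∧
    ∀ ψ, IsTestFunction Ω ψ →
      (∫ x in Ω, inner ℝ (partialXi j x (u x) (G x)) (gradient ψ x)) +
        (∫ x in Ω, partialS j x (u x) (G x) * ψ x) =
        ∫ x in Ω, g x (u x) * ψ x

end QuasiLinear

end

/-! Formally, with `u = φ(v)` one has ∇u = φ'(v)∇v, and the chain rule gives j♯_ξ(x,v,∇v) = φ'(v)
j_ξ(x,u,∇u) and j♯_s(x,v,∇v) = φ'(v) j_s(x,u,∇u) + φ''(v) j_ξ(x,u,∇u)·∇v. Testing the transformed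
equation with w/φ'(v), whose gradient is ∇w/φ'(v) - (wφ''(v)/φ'(v)²)∇v, makes the two terms
containing φ'' cancel, and what remains is the original equation tested with w
(`identity_of_sharp`).

The test function is admissible because w ∈ V_u forces |v| ≤ m on {w ≠ 0} for some m: there v may be
replaced by the bounded H¹₀ function T_m(v), and chain and product rules for bounded functions apply
(`MemH10With.div_deriv`).

The integrability conditions transfer through the asymptotics of φ: sφ''/φ' is bounded, which
isolates vφ'(v)j_s from v j♯_s, and |φ(s)| ≤ C|sφ'(s)| then controls u j_s. If v is bounded, so is
u; then u is one of its own truncations, every test function lies in V_u, and the equation holds in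
the sense of distributions.

Since H¹₀ is given as a closure of test functions, calculus in it is built by approximation. The
chain rule for the primitive of h is proved for h smooth and bounded, then continuous and bounded,
then the indicator of a closed set. The indicator of [-k,k] yields truncations, and that of {0}
yields ∇u = 0 a.e. on {u = 0}. -/

open scoped ENNReal

namespace QuasiLinear

variable {N : ℕ} {Ω : Set (EuclideanSpace ℝ (Fin N))}

/-! ### Convergence in `L²` -/

/-- Dominated convergence in `L²`, for a sequence tending to zero. -/
theorem tendsto_eLpNorm_two_of_dominated {X E : Type*} [MeasurableSpace X] [NormedAddCommGroup E]
    {m : Measure X} {f : ℕ → X → E} {b : X → ℝ} (hf : ∀ n, AEStronglyMeasurable (f n) m)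
    (hb : MemLp b 2 m) (hfb : ∀ n, ∀ᵐ x ∂m, ‖f n x‖ ≤ b x)
    (hlim : ∀ᵐ x ∂m, Tendsto (fun n => f n x) atTop (𝓝 0)) :
    Tendsto (fun n => eLpNorm (f n) 2 m) atTop (𝓝 0) := by
  have key : Tendsto (fun n => ∫⁻ x, ‖f n x‖ₑ ^ (2 : ℝ) ∂m) atTop (𝓝 (∫⁻ _, 0 ∂m)) := by
    refine tendsto_lintegral_of_dominated_convergence' (fun x => ‖b x‖ₑ ^ (2 : ℝ)) ?_ ?_ ?_ ?_
    · exact fun n => (hf n).enorm.pow_const _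
    · intro n
      filter_upwards [hfb n] with x hx
      gcongr
      rw [enorm_le_iff_norm_le]
      exact hx.trans (le_abs_self _)
    · have := hb.2
      rw [eLpNorm_lt_top_iff_lintegral_rpow_enorm_lt_top (by simp) (by simp)] at this
      simpa using this.ne
    · filter_upwards [hlim] with x hx
      have h1 : Tendsto (fun n => ‖f n x‖ₑ) atTop (𝓝 0) := by
        simpa using hx.enorm
      have := (ENNReal.continuous_rpow_const (y := (2 : ℝ))).tendsto 0 |>.comp h1
      simpa [Function.comp_def] using this
  simp only [lintegral_zero] at key
  have := (ENNReal.continuous_rpow_const (y := (1 / 2 : ℝ))).tendsto 0 |>.comp key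
  simp only [eLpNorm_eq_lintegral_rpow_enorm_toReal (p := 2) (by simp) (by simp)]
  simpa [Function.comp_def] using this

/-- Multiplying an `L²`-convergent sequence by a fixed `L²` function gives convergent integrals. -/
theorem tendsto_integral_smul_of_tendsto_eLpNorm {X E : Type*} [MeasurableSpace X]
    [NormedAddCommGroup E] [NormedSpace ℝ E] {m : Measure X} {f : ℕ → X → ℝ} {f₀ : X → ℝ}
    {F : X → E} (hf : ∀ n, MemLp (f n) 2 m) (hf₀ : MemLp f₀ 2 m) (hF : MemLp F 2 m)
    (h : Tendsto (fun n => eLpNorm (fun x => f n x - f₀ x) 2 m) atTop (𝓝 0)) :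
    Tendsto (fun n => ∫ x, f n x • F x ∂m) atTop (𝓝 (∫ x, f₀ x • F x ∂m)) := by
  refine tendsto_integral_of_L1' _ (hf₀.1.smul hF.1)
    (Eventually.of_forall fun n => memLp_one_iff_integrable.1 (hF.smul (hf n))) ?_
  have hlim : Tendsto (fun n => eLpNorm (fun x => f n x - f₀ x) 2 m * eLpNorm F 2 m) atTop
      (𝓝 0) := by
    simpa using ENNReal.Tendsto.mul_const h (Or.inr hF.2.ne)
  refine tendsto_of_tendsto_of_tendsto_of_le_of_le tendsto_const_nhds hlim
    (fun _ => zero_le) fun n => ?_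
  have := eLpNorm_smul_le_mul_eLpNorm (p := 2) (q := 2) (r := 1) hF.1 ((hf n).1.sub hf₀.1)
  refine le_trans (le_of_eq ?_) this
  congr 1
  ext x
  simp [sub_smul]

theorem tendsto_integral_smul_right_of_tendsto_eLpNorm {X E : Type*} [MeasurableSpace X]
    [NormedAddCommGroup E] [NormedSpace ℝ E] {m : Measure X} {F : ℕ → X → E} {F₀ : X → E}
    {f : X → ℝ} (hF : ∀ n, MemLp (F n) 2 m) (hF₀ : MemLp F₀ 2 m) (hf : MemLp f 2 m)
    (h : Tendsto (fun n => eLpNorm (fun x => F n x - F₀ x) 2 m) atTop (𝓝 0)) :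
    Tendsto (fun n => ∫ x, f x • F n x ∂m) atTop (𝓝 (∫ x, f x • F₀ x ∂m)) := by
  refine tendsto_integral_of_L1' _ (hf.1.smul hF₀.1)
    (Eventually.of_forall fun n => memLp_one_iff_integrable.1 ((hF n).smul hf)) ?_
  have hlim : Tendsto (fun n => eLpNorm f 2 m * eLpNorm (fun x => F n x - F₀ x) 2 m) atTop
      (𝓝 0) := by
    simpa using ENNReal.Tendsto.const_mul h (Or.inr hf.2.ne)
  refine tendsto_of_tendsto_of_tendsto_of_le_of_le tendsto_const_nhds hlim
    (fun _ => zero_le) fun n => ?_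
  have := eLpNorm_smul_le_mul_eLpNorm (p := 2) (q := 2) (r := 1) ((hF n).1.sub hF₀.1) hf.1
  refine le_trans (le_of_eq ?_) this
  congr 1
  ext x
  simp [smul_sub]

/-! ### Test functions -/

theorem IsTestFunction.continuous_gradient {ψ : EuclideanSpace ℝ (Fin N) → ℝ}
    (hψ : IsTestFunction Ω ψ) : Continuous (gradient ψ) :=
  (InnerProductSpace.toDual ℝ _).symm.continuous.comp (hψ.1.continuous_fderiv (by simp))

theorem IsTestFunction.hasCompactSupport_gradient {ψ : EuclideanSpace ℝ (Fin N) → ℝ}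
    (hψ : IsTestFunction Ω ψ) : HasCompactSupport (gradient ψ) :=
  (hψ.2.1.fderiv (𝕜 := ℝ)).comp_left (g := (InnerProductSpace.toDual ℝ _).symm) (map_zero _)

theorem IsTestFunction.memLp {ψ : EuclideanSpace ℝ (Fin N) → ℝ}
    (hψ : IsTestFunction Ω ψ) (p : ℝ≥0∞) : MemLp ψ p (volume.restrict Ω) :=
  (hψ.1.continuous.memLp_of_hasCompactSupport hψ.2.1).restrict Ω

theorem IsTestFunction.memLp_gradient {ψ : EuclideanSpace ℝ (Fin N) → ℝ}
    (hψ : IsTestFunction Ω ψ) (p : ℝ≥0∞) : MemLp (gradient ψ) p (volume.restrict Ω) :=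
  (hψ.continuous_gradient.memLp_of_hasCompactSupport hψ.hasCompactSupport_gradient).restrict Ω

theorem IsTestFunction.differentiable {ψ : EuclideanSpace ℝ (Fin N) → ℝ}
    (hψ : IsTestFunction Ω ψ) : Differentiable ℝ ψ :=
  hψ.1.differentiable (by simp)

theorem IsTestFunction.eq_zero {ψ : EuclideanSpace ℝ (Fin N) → ℝ}
    (hψ : IsTestFunction Ω ψ) {x : EuclideanSpace ℝ (Fin N)} (hx : x ∉ Ω) : ψ x = 0 :=
  image_eq_zero_of_notMem_tsupport fun h => hx (hψ.2.2 h)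

theorem inner_gradient_right {ψ : EuclideanSpace ℝ (Fin N) → ℝ}
    (x v : EuclideanSpace ℝ (Fin N)) : inner ℝ v (gradient ψ x) = fderiv ℝ ψ x v := by
  rw [real_inner_comm]
  simp [gradient]

/-- Both functions vanish off Ω, so the integrals run over the whole space and no boundary term
arises. Pairing with a constant vector reduces the identity to scalar integration by parts in one
direction. -/
theorem IsTestFunction.integral_smul_gradient {ψ χ : EuclideanSpace ℝ (Fin N) → ℝ}
    (hψ : IsTestFunction Ω ψ) (hχ : IsTestFunction Ω χ) :
    ∫ x in Ω, ψ x • gradient χ x = - ∫ x in Ω, χ x • gradient ψ x := by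
  have aux : ∀ {a b : EuclideanSpace ℝ (Fin N) → ℝ}, IsTestFunction Ω a → IsTestFunction Ω b →
      Integrable (fun x => a x • gradient b x) := fun ha hb =>
    (ha.1.continuous.smul hb.continuous_gradient).integrable_of_hasCompactSupport
      ha.2.1.smul_right
  rw [setIntegral_eq_integral_of_forall_compl_eq_zero fun x hx => by simp [hψ.eq_zero hx],
    setIntegral_eq_integral_of_forall_compl_eq_zero fun x hx => by simp [hχ.eq_zero hx]]
  refine ext_inner_left ℝ fun v => ?_
  rw [inner_neg_right, ← integral_inner (aux hψ hχ), ← integral_inner (aux hχ hψ)]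
  simp only [inner_smul_right, inner_gradient_right]
  have i1 := (aux hψ hχ).const_inner (𝕜 := ℝ) v
  have i2 := (aux hχ hψ).const_inner (𝕜 := ℝ) v
  simp only [inner_smul_right, inner_gradient_right] at i1 i2
  rw [integral_mul_fderiv_eq_neg_fderiv_mul_of_integrable _ i1 _
    (fun x _ => hψ.differentiable x) (fun x _ => hχ.differentiable x)]
  · simp only [mul_comm]
  · simpa only [mul_comm] using i2
  · exact (hψ.1.continuous.mul hχ.1.continuous).integrable_of_hasCompactSupport hψ.2.1.mul_right

/-! ### Weak gradients and `H¹₀` -/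

theorem locallyIntegrableOn_of_memLp {E : Type*} [NormedAddCommGroup E]
    [IsFiniteMeasure (volume.restrict Ω)] {f : EuclideanSpace ℝ (Fin N) → E}
    (hf : MemLp f 2 (volume.restrict Ω)) : LocallyIntegrableOn f Ω :=
  IntegrableOn.locallyIntegrableOn (hf.integrable (by norm_num))

/-- An `H¹`-limit of test functions belongs to `H¹₀`. -/
theorem memH10With_of_tendsto [IsFiniteMeasure (volume.restrict Ω)]
    {u : EuclideanSpace ℝ (Fin N) → ℝ} {G : EuclideanSpace ℝ (Fin N) → EuclideanSpace ℝ (Fin N)}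
    (hu : MemLp u 2 (volume.restrict Ω)) (hG : MemLp G 2 (volume.restrict Ω))
    {ψ : ℕ → EuclideanSpace ℝ (Fin N) → ℝ} (hψ : ∀ n, IsTestFunction Ω (ψ n))
    (h₀ : Tendsto (fun n => eLpNorm (fun x => ψ n x - u x) 2 (volume.restrict Ω)) atTop (𝓝 0))
    (h₁ : Tendsto (fun n => eLpNorm (fun x => gradient (ψ n) x - G x) 2 (volume.restrict Ω))
      atTop (𝓝 0)) : MemH10With Ω u G := by
  refine ⟨hu, hG, ⟨locallyIntegrableOn_of_memLp hu, locallyIntegrableOn_of_memLp hG,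
    fun χ hχ => ?_⟩, ψ, hψ, h₀, h₁⟩
  have l₀ := tendsto_integral_smul_of_tendsto_eLpNorm (fun n => (hψ n).memLp 2) hu
    (hχ.memLp_gradient 2) h₀
  have l₁ := tendsto_integral_smul_right_of_tendsto_eLpNorm (fun n => (hψ n).memLp_gradient 2) hG
    (hχ.memLp 2) h₁
  -- Integration by parts holds along the sequence, and both of its sides converge because χ and its
  -- gradient are in L².
  simp only [(hψ _).integral_smul_gradient hχ] at l₀
  exact tendsto_nhds_unique l₀ l₁.neg

theorem IsTestFunction.memH10With [IsFiniteMeasure (volume.restrict Ω)]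
    {ψ : EuclideanSpace ℝ (Fin N) → ℝ} (hψ : IsTestFunction Ω ψ) :
    MemH10With Ω ψ (gradient ψ) :=
  memH10With_of_tendsto (hψ.memLp 2) (hψ.memLp_gradient 2) (ψ := fun _ => ψ) (fun _ => hψ)
    (by simp) (by simp)

theorem MemH10With.congr_ae [IsFiniteMeasure (volume.restrict Ω)]
    {u u' : EuclideanSpace ℝ (Fin N) → ℝ}
    {G G' : EuclideanSpace ℝ (Fin N) → EuclideanSpace ℝ (Fin N)} (h : MemH10With Ω u G)
    (hu : u =ᵐ[volume.restrict Ω] u') (hG : G =ᵐ[volume.restrict Ω] G') :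
    MemH10With Ω u' G' := by
  obtain ⟨h1, h2, -, ψ, hψ, h3, h4⟩ := h
  refine memH10With_of_tendsto (h1.ae_eq hu) (h2.ae_eq hG) hψ (h3.congr fun n => ?_)
    (h4.congr fun n => ?_)
  · exact eLpNorm_congr_ae (by filter_upwards [hu] with x hx; rw [hx])
  · exact eLpNorm_congr_ae (by filter_upwards [hG] with x hx; rw [hx])

/-- Weak gradients are unique up to equality almost everywhere. -/
theorem HasWeakGradient.ae_eq (hΩ : IsOpen Ω) {u u' : EuclideanSpace ℝ (Fin N) → ℝ}
    {G G' : EuclideanSpace ℝ (Fin N) → EuclideanSpace ℝ (Fin N)} (h : HasWeakGradient Ω u G)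
    (h' : HasWeakGradient Ω u' G') (hu : u =ᵐ[volume.restrict Ω] u') :
    G =ᵐ[volume.restrict Ω] G' := by
  have key := hΩ.ae_eq_zero_of_integral_contDiff_smul_eq_zero (μ := volume) (h.2.1.sub h'.2.1) ?_
  · rw [EventuallyEq, ae_restrict_iff' hΩ.measurableSet]
    filter_upwards [key] with x hx hxΩ
    exact sub_eq_zero.1 (hx hxΩ)
  intro χ hχ hχc hχΩ
  have hχt : IsTestFunction Ω χ := ⟨hχ, hχc, hχΩ⟩
  have int : ∀ {F : EuclideanSpace ℝ (Fin N) → EuclideanSpace ℝ (Fin N)},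
      LocallyIntegrableOn F Ω → Integrable (fun x => χ x • F x) (volume.restrict Ω) := by
    intro F hF
    have := (hF.integrableOn_compact_subset hχΩ hχc).continuousOn_smul hχ.continuous.continuousOn hχc
    rw [integrableOn_iff_integrable_of_support_subset
      (fun x hx => subset_tsupport _ fun h0 => hx (by simp [h0]))] at this
    exact this.restrict
  have e : ∫ x, χ x • (G - G') x = ∫ x in Ω, χ x • (G - G') x :=
    (setIntegral_eq_integral_of_forall_compl_eq_zero fun x hx => by simp [hχt.eq_zero hx]).symm
  rw [e]
  simp only [Pi.sub_apply, smul_sub]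
  rw [integral_sub (int h.2.1) (int h'.2.1), sub_eq_zero, ← neg_inj, ← h.2.2 χ hχt,
    ← h'.2.2 χ hχt]
  exact integral_congr_ae (by filter_upwards [hu] with x hx; rw [hx])

theorem IsTestFunction.add {ψ χ : EuclideanSpace ℝ (Fin N) → ℝ}
    (hψ : IsTestFunction Ω ψ) (hχ : IsTestFunction Ω χ) :
    IsTestFunction Ω (fun x => ψ x + χ x) :=
  ⟨hψ.1.add hχ.1, hψ.2.1.add hχ.2.1,
    (tsupport_add ψ χ).trans (Set.union_subset hψ.2.2 hχ.2.2)⟩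

/-- Composing a test function with a smooth function vanishing at zero. -/
theorem IsTestFunction.comp {ψ : EuclideanSpace ℝ (Fin N) → ℝ} (hψ : IsTestFunction Ω ψ)
    {f : ℝ → ℝ} (hf : ContDiff ℝ ∞ f) (h0 : f 0 = 0) : IsTestFunction Ω (fun x => f (ψ x)) :=
  ⟨hf.comp hψ.1, hψ.2.1.comp_left h0, (tsupport_comp_subset h0 ψ).trans hψ.2.2⟩

theorem gradient_comp {ψ : EuclideanSpace ℝ (Fin N) → ℝ} {f : ℝ → ℝ} {f' : ℝ}
    {x : EuclideanSpace ℝ (Fin N)} (hψ : DifferentiableAt ℝ ψ x) (hf : HasDerivAt f f' (ψ x)) :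
    gradient (fun y => f (ψ y)) x = f' • gradient ψ x := by
  have := hf.comp_hasFDerivAt x hψ.hasFDerivAt
  have h2 : fderiv ℝ (fun y => f (ψ y)) x = f' • fderiv ℝ ψ x := this.fderiv
  simp [gradient, h2]

theorem gradient_add {ψ χ : EuclideanSpace ℝ (Fin N) → ℝ}
    {x : EuclideanSpace ℝ (Fin N)} (hψ : DifferentiableAt ℝ ψ x) (hχ : DifferentiableAt ℝ χ x) :
    gradient (fun y => ψ y + χ y) x = gradient ψ x + gradient χ x := by
  simp [gradient, fderiv_fun_add hψ hχ]

theorem MemH10With.add [IsFiniteMeasure (volume.restrict Ω)]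
    {u u' : EuclideanSpace ℝ (Fin N) → ℝ}
    {G G' : EuclideanSpace ℝ (Fin N) → EuclideanSpace ℝ (Fin N)} (h : MemH10With Ω u G)
    (h' : MemH10With Ω u' G') :
    MemH10With Ω (fun x => u x + u' x) (fun x => G x + G' x) := by
  obtain ⟨h1, h2, -, ψ, hψ, h3, h4⟩ := h
  obtain ⟨h1', h2', -, ψ', hψ', h3', h4'⟩ := h'
  refine memH10With_of_tendsto (h1.add h1') (h2.add h2')
    (ψ := fun n x => ψ n x + ψ' n x) (fun n => (hψ n).add (hψ' n)) ?_ ?_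
  · have l := h3.add h3'
    rw [add_zero] at l
    refine tendsto_of_tendsto_of_tendsto_of_le_of_le tendsto_const_nhds l
      (fun _ => zero_le) fun n => ?_
    refine le_trans (le_of_eq ?_) (eLpNorm_add_le (((hψ n).memLp 2).1.sub h1.1)
      (((hψ' n).memLp 2).1.sub h1'.1) (by norm_num))
    congr 1; ext x; simp; ring
  · have l := h4.add h4'
    rw [add_zero] at l
    refine tendsto_of_tendsto_of_tendsto_of_le_of_le tendsto_const_nhds l
      (fun _ => zero_le) fun n => ?_
    refine le_trans (le_of_eq ?_) (eLpNorm_add_le (((hψ n).memLp_gradient 2).1.sub h2.1)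
      (((hψ' n).memLp_gradient 2).1.sub h2'.1) (by norm_num))
    congr 1; ext x
    simp only [gradient_add ((hψ n).differentiable x) ((hψ' n).differentiable x), Pi.add_apply]
    abel_nf

theorem MemH10With.const_smul [IsFiniteMeasure (volume.restrict Ω)]
    {u : EuclideanSpace ℝ (Fin N) → ℝ}
    {G : EuclideanSpace ℝ (Fin N) → EuclideanSpace ℝ (Fin N)} (h : MemH10With Ω u G) (c : ℝ) :
    MemH10With Ω (fun x => c * u x) (fun x => c • G x) := by
  obtain ⟨h1, h2, -, ψ, hψ, h3, h4⟩ := h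
  refine memH10With_of_tendsto (h1.const_mul c) (h2.const_smul c)
    (ψ := fun n x => c * ψ n x)
    (fun n => (hψ n).comp (f := fun t => c * t) (contDiff_const.mul contDiff_id) (by simp)) ?_ ?_
  · have l := ENNReal.Tendsto.const_mul (a := ‖c‖ₑ) h3 (Or.inr (by simp))
    rw [mul_zero] at l
    refine l.congr fun n => ?_
    rw [← eLpNorm_const_smul]
    congr 1; ext x; simp [mul_sub]
  · have l := ENNReal.Tendsto.const_mul (a := ‖c‖ₑ) h4 (Or.inr (by simp))
    rw [mul_zero] at l
    refine l.congr fun n => ?_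
    rw [← eLpNorm_const_smul]
    congr 1; ext1 x
    have hd : HasDerivAt (fun t => c * t) c (ψ n x) := by
      simpa using (hasDerivAt_id (ψ n x)).const_mul c
    rw [gradient_comp ((hψ n).differentiable x) hd]
    simp [smul_sub]

/-- `H¹₀` is closed under convergence in `H¹`. -/
theorem memH10With_of_tendsto_memH10With [IsFiniteMeasure (volume.restrict Ω)]
    {u : EuclideanSpace ℝ (Fin N) → ℝ} {G : EuclideanSpace ℝ (Fin N) → EuclideanSpace ℝ (Fin N)}
    (hu : MemLp u 2 (volume.restrict Ω)) (hG : MemLp G 2 (volume.restrict Ω))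
    {w : ℕ → EuclideanSpace ℝ (Fin N) → ℝ}
    {H : ℕ → EuclideanSpace ℝ (Fin N) → EuclideanSpace ℝ (Fin N)}
    (hw : ∀ n, MemH10With Ω (w n) (H n))
    (h₀ : Tendsto (fun n => eLpNorm (fun x => w n x - u x) 2 (volume.restrict Ω)) atTop (𝓝 0))
    (h₁ : Tendsto (fun n => eLpNorm (fun x => H n x - G x) 2 (volume.restrict Ω))
      atTop (𝓝 0)) : MemH10With Ω u G := by
  -- A diagonal sequence, with error 1/n at stage n. For n = 0 the inverse is ⊤ and the bound is
  -- empty.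
  have approx : ∀ n : ℕ, ∃ ψ, IsTestFunction Ω ψ ∧
      eLpNorm (fun x => ψ x - w n x) 2 (volume.restrict Ω) ≤ (n : ℝ≥0∞)⁻¹ ∧
      eLpNorm (fun x => gradient ψ x - H n x) 2 (volume.restrict Ω) ≤ (n : ℝ≥0∞)⁻¹ := by
    intro n
    obtain ⟨-, -, -, ψ, hψ, h3, h4⟩ := hw n
    have hpos : (0 : ℝ≥0∞) < (n : ℝ≥0∞)⁻¹ := by simp
    obtain ⟨k, hk⟩ := ((h3.eventually_le_const hpos).and (h4.eventually_le_const hpos)).exists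
    exact ⟨ψ k, hψ k, hk⟩
  choose ψ hψ h3 h4 using approx
  refine memH10With_of_tendsto hu hG hψ ?_ ?_
  · have l := ENNReal.tendsto_inv_nat_nhds_zero.add h₀
    rw [add_zero] at l
    refine tendsto_of_tendsto_of_tendsto_of_le_of_le tendsto_const_nhds l
      (fun _ => zero_le) fun n => ?_
    refine le_trans ?_ (add_le_add_left (h3 n) _)
    refine le_trans (le_of_eq ?_) (eLpNorm_add_le (((hψ n).memLp 2).1.sub (hw n).1.1)
      ((hw n).1.1.sub hu.1) (by norm_num))
    congr 1; ext x; simp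
  · have l := ENNReal.tendsto_inv_nat_nhds_zero.add h₁
    rw [add_zero] at l
    refine tendsto_of_tendsto_of_tendsto_of_le_of_le tendsto_const_nhds l
      (fun _ => zero_le) fun n => ?_
    refine le_trans ?_ (add_le_add_left (h4 n) _)
    refine le_trans (le_of_eq ?_) (eLpNorm_add_le (((hψ n).memLp_gradient 2).1.sub (hw n).2.1.1)
      ((hw n).2.1.1.sub hG.1) (by norm_num))
    congr 1; ext1 x; simp

/-! ### Chain rules in `H¹₀` -/

theorem intervalIntegrable_of_bounded {h : ℝ → ℝ} (hm : Measurable h) {C : ℝ}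
    (hC : ∀ t, |h t| ≤ C) (a b : ℝ) : IntervalIntegrable h volume a b :=
  intervalIntegrable_const (c := C) |>.mono_fun hm.aestronglyMeasurable
    (Eventually.of_forall fun t => (hC t).trans (le_abs_self _))

theorem abs_integral_sub_integral_le {h : ℝ → ℝ} (hm : Measurable h) {C : ℝ}
    (hC : ∀ t, |h t| ≤ C) (a b : ℝ) :
    |(∫ t in 0..a, h t) - ∫ t in 0..b, h t| ≤ C * |a - b| := by
  have hi := intervalIntegrable_of_bounded hm hC
  rw [intervalIntegral.integral_interval_sub_left (hi _ _) (hi _ _)]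
  exact intervalIntegral.norm_integral_le_of_norm_le_const (f := h) fun t _ => hC t

theorem memLp_primitive_comp {h : ℝ → ℝ} (hm : Measurable h) {C : ℝ} (hC : ∀ t, |h t| ≤ C)
    {X : Type*} [MeasurableSpace X] {m : Measure X} {u : X → ℝ} (hu : MemLp u 2 m) :
    MemLp (fun x => ∫ t in 0..u x, h t) 2 m := by
  have hc : Continuous fun a => ∫ t in 0..a, h t :=
    intervalIntegral.continuous_primitive (intervalIntegrable_of_bounded hm hC) 0
  refine hu.of_le_mul (c := C) (hc.comp_aestronglyMeasurable hu.1)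
    (Eventually.of_forall fun x => ?_)
  simpa using abs_integral_sub_integral_le hm hC (u x) 0

theorem memLp_bounded_comp_smul {h : ℝ → ℝ} (hm : Measurable h) {C : ℝ} (hC : ∀ t, |h t| ≤ C)
    {X E : Type*} [MeasurableSpace X] [NormedAddCommGroup E] [NormedSpace ℝ E] {m : Measure X}
    {u : X → ℝ} (hu : AEMeasurable u m) {G : X → E} (hG : MemLp G 2 m) :
    MemLp (fun x => h (u x) • G x) 2 m := by
  refine hG.of_le_mul (c := C) ((hm.comp_aemeasurable hu).aestronglyMeasurable.smul hG.1)
    (Eventually.of_forall fun x => ?_)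
  rw [norm_smul]
  exact mul_le_mul_of_nonneg_right (hC _) (norm_nonneg _)

/-- The primitive of h is smooth and vanishes at zero, so composing it with the approximating test
functions ψₙ gives test functions again. The gradient error splits as h(ψₙ)(∇ψₙ - G) + (h(ψₙ) -
h(u))G: the first part is small since h is bounded, the second by dominated convergence. -/
theorem MemH10With.primitive_comp_of_contDiff [IsFiniteMeasure (volume.restrict Ω)]
    {u : EuclideanSpace ℝ (Fin N) → ℝ}
    {G : EuclideanSpace ℝ (Fin N) → EuclideanSpace ℝ (Fin N)} (hu : MemH10With Ω u G)
    {h : ℝ → ℝ} (hh : ContDiff ℝ ∞ h) {C : ℝ} (hC : ∀ t, |h t| ≤ C) :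
    MemH10With Ω (fun x => ∫ t in 0..u x, h t) (fun x => h (u x) • G x) := by
  obtain ⟨h1, h2, -, ψ', hψ', h3', h4'⟩ := hu
  have hm : Measurable h := hh.continuous.measurable
  have hC0 : 0 ≤ C := (abs_nonneg _).trans (hC 0)
  -- Dominated convergence for (h(ψₙ) - h(u))G needs pointwise convergence, available only along a
  -- subsequence.
  obtain ⟨ns, hns, hae⟩ := (tendstoInMeasure_of_tendsto_eLpNorm two_ne_zero
    (fun n => ((hψ' n).memLp 2).1) h1.1 h3').exists_seq_tendsto_ae
  have h3 := h3'.comp hns.tendsto_atTop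
  have h4 := h4'.comp hns.tendsto_atTop
  have hd : ∀ a, HasDerivAt (fun a => ∫ t in 0..a, h t) (h a) a := fun a =>
    intervalIntegral.integral_hasDerivAt_right (intervalIntegrable_of_bounded hm hC _ _)
      (hh.continuous.stronglyMeasurableAtFilter _ _) hh.continuous.continuousAt
  have hF : ContDiff ℝ ∞ fun a => ∫ t in 0..a, h t := by
    rw [contDiff_infty_iff_deriv]
    refine ⟨fun a => (hd a).differentiableAt, ?_⟩
    rwa [show deriv (fun a => ∫ t in 0..a, h t) = h from funext fun a => (hd a).deriv]
  refine memH10With_of_tendsto (memLp_primitive_comp hm hC h1)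
    (memLp_bounded_comp_smul hm hC h1.1.aemeasurable h2)
    (fun n => (hψ' (ns n)).comp hF (by simp)) ?_ ?_
  · have l := ENNReal.Tendsto.const_mul (a := ‖C‖ₑ) h3 (Or.inr (by simp))
    rw [mul_zero] at l
    refine tendsto_of_tendsto_of_tendsto_of_le_of_le tendsto_const_nhds l
      (fun _ => zero_le) fun n => ?_
    simp only [Function.comp_apply]
    rw [← eLpNorm_const_smul]
    refine eLpNorm_mono fun x => ?_
    refine (abs_integral_sub_integral_le hm hC _ _).trans_eq ?_
    simp [abs_of_nonneg hC0]
  · have l1 := ENNReal.Tendsto.const_mul (a := ‖C‖ₑ) h4 (Or.inr (by simp))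
    have l2 : Tendsto (fun n => eLpNorm (fun x => (h (ψ' (ns n) x) - h (u x)) • G x) 2
        (volume.restrict Ω)) atTop (𝓝 0) := by
      refine tendsto_eLpNorm_two_of_dominated (b := fun x => (C + C) * ‖G x‖) (fun n => ?_)
        (h2.norm.const_mul _) (fun n => Eventually.of_forall fun x => ?_) ?_
      · exact ((hm.comp_aemeasurable ((hψ' _).memLp 2).1.aemeasurable).sub
          (hm.comp_aemeasurable h1.1.aemeasurable)).aestronglyMeasurable.smul h2.1
      · rw [norm_smul]
        gcongr
        exact (norm_sub_le _ _).trans (add_le_add (hC _) (hC _))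
      · filter_upwards [hae] with x hx
        have := ((hh.continuous.tendsto _).comp hx).sub_const (h (u x)) |>.smul_const (G x)
        simpa using this
    have l := l1.add l2
    rw [mul_zero, add_zero] at l
    refine tendsto_of_tendsto_of_tendsto_of_le_of_le tendsto_const_nhds l
      (fun _ => zero_le) fun n => ?_
    simp only [Function.comp_apply]
    rw [← eLpNorm_const_smul]
    have e : (fun x => gradient (fun y => ∫ t in 0..ψ' (ns n) y, h t) x - h (u x) • G x) =
        (fun x => h (ψ' (ns n) x) • (gradient (ψ' (ns n)) x - G x)) +
          fun x => (h (ψ' (ns n) x) - h (u x)) • G x := by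
      ext1 x
      rw [gradient_comp ((hψ' (ns n)).differentiable x) (hd _)]
      simp only [Pi.add_apply, smul_sub, sub_smul]
      abel
    rw [e]
    refine (eLpNorm_add_le ?_ ?_ (by norm_num)).trans (add_le_add_left (eLpNorm_mono fun x => ?_) _)
    · exact (hm.comp_aemeasurable ((hψ' _).memLp 2).1.aemeasurable).aestronglyMeasurable.smul
        (((hψ' _).memLp_gradient 2).1.sub h2.1)
    · exact ((hm.comp_aemeasurable ((hψ' _).memLp 2).1.aemeasurable).sub
          (hm.comp_aemeasurable h1.1.aemeasurable)).aestronglyMeasurable.smul h2.1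
    · rw [Pi.smul_apply, norm_smul, norm_smul]
      gcongr
      exact (hC _).trans (le_abs_self _)

/-- The chain rule passes to bounded pointwise limits of the derivatives. -/
theorem MemH10With.primitive_comp_of_tendsto [IsFiniteMeasure (volume.restrict Ω)]
    {u : EuclideanSpace ℝ (Fin N) → ℝ}
    {G : EuclideanSpace ℝ (Fin N) → EuclideanSpace ℝ (Fin N)} (hu : MemH10With Ω u G)
    {f : ℕ → ℝ → ℝ} {h : ℝ → ℝ} {C : ℝ} (hf : ∀ n, Measurable (f n)) (hC : ∀ n t, |f n t| ≤ C)
    (hlim : ∀ t, Tendsto (fun n => f n t) atTop (𝓝 (h t)))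
    (hfu : ∀ n, MemH10With Ω (fun x => ∫ t in 0..u x, f n t) (fun x => f n (u x) • G x)) :
    MemH10With Ω (fun x => ∫ t in 0..u x, h t) (fun x => h (u x) • G x) := by
  have h1 := hu.1
  have h2 := hu.2.1
  have hC0 : 0 ≤ C := (abs_nonneg _).trans (hC 0 0)
  have hm : Measurable h := measurable_of_tendsto_metrizable hf (tendsto_pi_nhds.2 hlim)
  have hhC : ∀ t, |h t| ≤ C := fun t =>
    le_of_tendsto (hlim t).abs (Eventually.of_forall fun n => hC n t)
  have m1 := memLp_primitive_comp hm hhC h1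
  have m2 := memLp_bounded_comp_smul hm hhC h1.1.aemeasurable h2
  refine memH10With_of_tendsto_memH10With m1 m2 hfu ?_ ?_
  · refine tendsto_eLpNorm_two_of_dominated (b := fun x => (C + C) * |u x|)
      (fun n => (hfu n).1.1.sub m1.1)
      (h1.norm.const_mul _) (fun n => Eventually.of_forall fun x => ?_)
      (Eventually.of_forall fun x => ?_)
    · refine (norm_sub_le _ _).trans ?_
      rw [add_mul]
      refine add_le_add ?_ ?_
      · simpa using abs_integral_sub_integral_le (hf n) (hC n) (u x) 0
      · simpa using abs_integral_sub_integral_le hm hhC (u x) 0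
    · have := (intervalIntegral.tendsto_integral_filter_of_dominated_convergence (μ := volume)
        (a := 0) (b := u x) (l := atTop) (F := f) (f := h) (fun _ => C)
        (Eventually.of_forall fun n => (hf n).aestronglyMeasurable)
        (Eventually.of_forall fun n => Eventually.of_forall fun t _ => hC n t)
        intervalIntegrable_const
        (Eventually.of_forall fun t _ => hlim t)).sub_const (∫ t in 0..u x, h t)
      simpa using this
  · refine tendsto_eLpNorm_two_of_dominated (b := fun x => (C + C) * ‖G x‖)
      (fun n => (hfu n).2.1.1.sub m2.1)
      (h2.norm.const_mul _) (fun n => Eventually.of_forall fun x => ?_)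
      (Eventually.of_forall fun x => ?_)
    · rw [← sub_smul, norm_smul]
      gcongr
      exact (norm_sub_le _ _).trans (add_le_add (hC _ _) (hhC _))
    · have := ((hlim (u x)).smul_const (G x)).sub_const (h (u x) • G x)
      simpa using this

/-- Smooth functions within 1/(n+1) of h, uniformly on the line, are all bounded by C + 1, so the
rule for smooth derivatives passes to the limit. -/
theorem MemH10With.primitive_comp [IsFiniteMeasure (volume.restrict Ω)]
    {u : EuclideanSpace ℝ (Fin N) → ℝ}
    {G : EuclideanSpace ℝ (Fin N) → EuclideanSpace ℝ (Fin N)} (hu : MemH10With Ω u G)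
    {h : ℝ → ℝ} (hh : Continuous h) {C : ℝ} (hC : ∀ t, |h t| ≤ C) :
    MemH10With Ω (fun x => ∫ t in 0..u x, h t) (fun x => h (u x) • G x) := by
  have approx : ∀ n : ℕ, ∃ f : ℝ → ℝ, ContDiff ℝ ∞ f ∧
      ∀ t, dist (f t) (h t) < 1 / ((n : ℝ) + 1) := by
    intro n
    obtain ⟨f, hf, hfh, -⟩ := hh.exists_contDiff_approx (n := ⊤) (ε := fun _ => 1 / ((n : ℝ) + 1))
      continuous_const (fun _ => by positivity)
    exact ⟨f, hf, hfh⟩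
  choose f hf hfh using approx
  have hbd : ∀ n t, |f n t| ≤ C + 1 := by
    intro n t
    have h1 := (hfh n t).le
    have h2 : 1 / ((n : ℝ) + 1) ≤ 1 := by
      rw [div_le_one (by positivity)]
      linarith [Nat.cast_nonneg (α := ℝ) n]
    rw [Real.dist_eq] at h1
    have h3 := abs_add_le (f n t - h t) (h t)
    rw [sub_add_cancel] at h3
    linarith [hC t]
  refine hu.primitive_comp_of_tendsto (fun n => (hf n).continuous.measurable) hbd (fun t => ?_)
    (fun n => hu.primitive_comp_of_contDiff (hf n) (hbd n))
  exact tendsto_iff_dist_tendsto_zero.2 (squeeze_zero (fun _ => dist_nonneg)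
    (fun n => (hfh n t).le) tendsto_one_div_add_atTop_nhds_zero_nat)

/-- The chain rule for primitives of indicators of closed sets. -/
theorem MemH10With.primitive_indicator_comp [IsFiniteMeasure (volume.restrict Ω)]
    {u : EuclideanSpace ℝ (Fin N) → ℝ}
    {G : EuclideanSpace ℝ (Fin N) → EuclideanSpace ℝ (Fin N)} (hu : MemH10With Ω u G)
    {S : Set ℝ} (hS : IsClosed S) :
    MemH10With Ω (fun x => ∫ t in 0..u x, S.indicator 1 t)
      (fun x => S.indicator (1 : ℝ → ℝ) (u x) • G x) := by
  -- Thickened indicators converge pointwise to the indicator of the closure; this is where S must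
  -- be closed.
  have hpos : ∀ n : ℕ, 0 < 1 / ((n : ℝ) + 1) := fun n => by positivity
  have hbd : ∀ (n : ℕ) (t : ℝ), |(thickenedIndicator (hpos n) S t : ℝ)| ≤ 1 := fun n t => by
    rw [abs_of_nonneg (NNReal.coe_nonneg _)]
    exact_mod_cast thickenedIndicator_le_one _ _ _
  have hcont : ∀ n : ℕ, Continuous fun t => (thickenedIndicator (hpos n) S t : ℝ) := fun n =>
    NNReal.continuous_coe.comp (thickenedIndicator (hpos n) S).continuous
  refine hu.primitive_comp_of_tendsto (fun n => (hcont n).measurable) hbd (fun t => ?_)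
    fun n => hu.primitive_comp (hcont n) (hbd n)
  have := tendsto_pi_nhds.1 (thickenedIndicator_tendsto_indicator_closure hpos
    tendsto_one_div_add_atTop_nhds_zero_nat S) t
  rw [hS.closure_eq] at this
  have h2 := (NNReal.continuous_coe.tendsto _).comp this
  by_cases ht : t ∈ S
  · simpa [ht, Function.comp_def] using h2
  · simpa [ht, Function.comp_def] using h2

/-! ### Truncations, vanishing of gradients on zero sets, and rules for bounded functions. -/

theorem abs_trunc_le {k : ℝ} (hk : 0 ≤ k) (s : ℝ) : |trunc k s| ≤ k := by
  rw [abs_le]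
  exact ⟨le_max_left _ _, max_le (by linarith) (min_le_right _ _)⟩

theorem trunc_of_abs_le {k s : ℝ} (h : |s| ≤ k) : trunc k s = s := by
  rw [abs_le] at h
  rw [trunc, min_eq_left h.2, max_eq_right h.1]

theorem continuous_trunc (k : ℝ) : Continuous (trunc k) := by
  unfold trunc
  fun_prop

theorem abs_trunc_le_iff {k m : ℝ} (hk : 0 ≤ k) (hkm : k < m) (s : ℝ) :
    |trunc m s| ≤ k ↔ |s| ≤ k := by
  unfold trunc
  rw [abs_le, abs_le]
  grind

theorem trunc_trunc {k m : ℝ} (hk : 0 ≤ k) (hkm : k ≤ m) (s : ℝ) :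
    trunc k (trunc m s) = trunc k s := by
  unfold trunc
  grind

/-- T_k is continuous and differentiable off ±k, with derivative the indicator of [-k,k]; a
countable exceptional set does not affect the fundamental theorem of calculus. -/
theorem integral_indicator_Icc {k : ℝ} (hk : 0 < k) (a : ℝ) :
    ∫ t in 0..a, (Set.Icc (-k) k).indicator (1 : ℝ → ℝ) t = trunc k a := by
  have hb : ∀ t, |(Set.Icc (-k) k).indicator (1 : ℝ → ℝ) t| ≤ 1 := fun t => by
    by_cases h : t ∈ Set.Icc (-k) k <;> simp [h]
  rw [integral_eq_of_hasDerivAt_off_countable (trunc k)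
    ((Set.Icc (-k) k).indicator (1 : ℝ → ℝ)) (s := {k, -k})
    (Set.Countable.insert _ (Set.countable_singleton _)) (continuous_trunc k).continuousOn ?_
    (intervalIntegrable_of_bounded (measurable_one.indicator measurableSet_Icc) hb _ _)]
  · rw [trunc_of_abs_le (s := 0) (by simpa using hk.le), sub_zero]
  rintro t ⟨-, ht⟩
  simp only [Set.mem_insert_iff, Set.mem_singleton_iff, not_or] at ht
  rcases lt_or_ge k t with h | h
  · have e : trunc k =ᶠ[𝓝 t] fun _ => k := by
      filter_upwards [lt_mem_nhds h] with y hy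
      unfold trunc
      grind
    rw [Set.indicator_of_notMem (by simp [h])]
    exact (hasDerivAt_const t k).congr_of_eventuallyEq e
  rcases lt_or_ge t (-k) with h' | h'
  · have e : trunc k =ᶠ[𝓝 t] fun _ => -k := by
      filter_upwards [gt_mem_nhds h'] with y hy
      unfold trunc
      grind
    rw [Set.indicator_of_notMem (by simp [h'])]
    exact (hasDerivAt_const t (-k)).congr_of_eventuallyEq e
  · have e : trunc k =ᶠ[𝓝 t] fun y => y := by
      filter_upwards [lt_mem_nhds (lt_of_le_of_ne h' (Ne.symm ht.2)),
        gt_mem_nhds (lt_of_le_of_ne h ht.1)] with y hy hy'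
      unfold trunc
      grind
    rw [Set.indicator_of_mem (Set.mem_Icc.2 ⟨h', h⟩)]
    exact (hasDerivAt_id t).congr_of_eventuallyEq e

/-- Truncations of `H¹₀` functions. -/
theorem MemH10With.trunc [IsFiniteMeasure (volume.restrict Ω)]
    {u : EuclideanSpace ℝ (Fin N) → ℝ}
    {G : EuclideanSpace ℝ (Fin N) → EuclideanSpace ℝ (Fin N)} (hu : MemH10With Ω u G)
    {k : ℝ} (hk : 0 < k) :
    MemH10With Ω (fun x => trunc k (u x)) (Set.indicator {x | |u x| ≤ k} G) := by
  have := hu.primitive_indicator_comp (S := Set.Icc (-k) k) isClosed_Icc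
  simp only [integral_indicator_Icc hk] at this
  convert this using 1
  ext1 x
  by_cases h : |u x| ≤ k
  · rw [Set.indicator_of_mem (by exact h), Set.indicator_of_mem (Set.mem_Icc.2 (abs_le.1 h))]
    simp
  · rw [Set.indicator_of_notMem (by exact h),
      Set.indicator_of_notMem (fun h' => h (abs_le.2 (Set.mem_Icc.1 h')))]
    simp

/-- The gradient of an `H¹₀` function vanishes almost everywhere on its zero set. -/
theorem MemH10With.ae_gradient_eq_zero [IsFiniteMeasure (volume.restrict Ω)] (hΩ : IsOpen Ω)
    {u : EuclideanSpace ℝ (Fin N) → ℝ}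
    {G : EuclideanSpace ℝ (Fin N) → EuclideanSpace ℝ (Fin N)} (hu : MemH10With Ω u G) :
    ∀ᵐ x ∂volume.restrict Ω, u x = 0 → G x = 0 := by
  have h1 := hu.primitive_indicator_comp (S := {0}) isClosed_singleton
  have h2 := hu.const_smul 0
  -- The indicator of a point has zero primitive, so the field equal to G on {u = 0} and to 0
  -- elsewhere is a weak gradient of the zero function. Uniqueness makes it vanish.
  have e : ∀ a : ℝ, ∫ t in 0..a, ({0} : Set ℝ).indicator (1 : ℝ → ℝ) t = 0 := fun a => by
    refine intervalIntegral.integral_zero_ae ?_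
    filter_upwards [Measure.ae_ne volume (0 : ℝ)] with t ht _
    simp [ht]
  simp only [e] at h1
  filter_upwards [h1.2.2.1.ae_eq hΩ h2.2.2.1 (by simp)] with x hx hux
  simpa [hux] using hx

/-- The chain rule for a bounded `H¹₀` function and a `C¹` function vanishing at zero. -/
theorem MemH10With.comp_of_bounded [IsFiniteMeasure (volume.restrict Ω)]
    {u : EuclideanSpace ℝ (Fin N) → ℝ}
    {G : EuclideanSpace ℝ (Fin N) → EuclideanSpace ℝ (Fin N)} (hu : MemH10With Ω u G)
    {m : ℝ} (hm : ∀ᵐ x ∂volume.restrict Ω, |u x| ≤ m) {f : ℝ → ℝ} (hf : ContDiff ℝ 1 f)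
    (hf0 : f 0 = 0) :
    MemH10With Ω (fun x => f (u x)) (fun x => deriv f (u x) • G x) := by
  rcases lt_or_ge m 0 with hm0 | hm0
  · have : ∀ᵐ x ∂volume.restrict Ω, False := by
      filter_upwards [hm] with x hx
      linarith [abs_nonneg (u x)]
    exact hu.congr_ae (this.mono fun _ h => h.elim) (this.mono fun _ h => h.elim)
  have hd : Continuous (deriv f) := hf.continuous_deriv le_rfl
  obtain ⟨C, hC⟩ := isCompact_Icc.exists_bound_of_continuousOn (s := Set.Icc (-m) m)
    hd.continuousOn
  -- Freezing f' outside [-m,m] makes it globally bounded without changing it on the range of u.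
  have h1 := hu.primitive_comp (hd.comp (continuous_trunc m)) (C := C)
    (fun t => hC _ (abs_le.1 (abs_trunc_le hm0 t)))
  refine h1.congr_ae ?_ ?_
  · filter_upwards [hm] with x hx
    have e : ∫ t in 0..u x, (deriv f ∘ QuasiLinear.trunc m) t = ∫ t in 0..u x, deriv f t := by
      refine intervalIntegral.integral_congr fun t ht => ?_
      have : |t| ≤ |u x| := by
        rcases Set.mem_uIcc.1 ht with h | h
        · rw [abs_of_nonneg h.1]; exact h.2.trans (le_abs_self _)
        · rw [abs_of_nonpos h.2]; exact (neg_le_neg h.1).trans (neg_le_abs _)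
      simp [trunc_of_abs_le (this.trans hx)]
    simp only [e]
    rw [intervalIntegral.integral_deriv_eq_sub (fun t _ => hf.differentiable one_ne_zero t)
      (hd.intervalIntegrable _ _), hf0, sub_zero]
  · filter_upwards [hm] with x hx
    simp [trunc_of_abs_le hx]

/-- The product rule for bounded `H¹₀` functions. -/
theorem MemH10With.mul_of_bounded [IsFiniteMeasure (volume.restrict Ω)]
    {u w : EuclideanSpace ℝ (Fin N) → ℝ}
    {G H : EuclideanSpace ℝ (Fin N) → EuclideanSpace ℝ (Fin N)} (hu : MemH10With Ω u G)
    (hw : MemH10With Ω w H) {m : ℝ} (hum : ∀ᵐ x ∂volume.restrict Ω, |u x| ≤ m)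
    (hwm : ∀ᵐ x ∂volume.restrict Ω, |w x| ≤ m) :
    MemH10With Ω (fun x => u x * w x) (fun x => w x • G x + u x • H x) := by
  have hsq : ContDiff ℝ 1 fun t : ℝ => t ^ 2 := contDiff_id.pow 2
  have hd : ∀ t : ℝ, deriv (fun t : ℝ => t ^ 2) t = 2 * t := fun t => by simp
  -- Polarization, uw = ((u+w)² - (u-w)²)/4, reduces the product rule to the chain rule for the
  -- square.
  have key : ∀ {w : EuclideanSpace ℝ (Fin N) → ℝ}
      {H : EuclideanSpace ℝ (Fin N) → EuclideanSpace ℝ (Fin N)}, MemH10With Ω w H →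
      (∀ᵐ x ∂volume.restrict Ω, |w x| ≤ m) → MemH10With Ω (fun x => (u x + w x) ^ 2)
        (fun x => (2 * (u x + w x)) • (G x + H x)) := by
    intro w H hw hwm
    have := (hu.add hw).comp_of_bounded (m := m + m) (by
      filter_upwards [hum, hwm] with x h1 h2
      exact (abs_add_le _ _).trans (add_le_add h1 h2)) hsq (by simp)
    simpa only [hd] using this
  have p := (key hw hwm).const_smul (1 / 4)
  have q := (key (hw.const_smul (-1)) (by simpa using hwm)).const_smul (-1 / 4)
  refine (p.add q).congr_ae (Eventually.of_forall fun x => ?_) (Eventually.of_forall fun x => ?_)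
  · simp only
    ring
  · simp only
    module

/-! ### Generalized gradients -/

/-- Weak gradients of the truncations are unique, and the countably many sets {|u| ≤ n+1} exhaust
the space because u is real-valued. -/
theorem IsGenGradient.ae_eq (hΩ : IsOpen Ω) {u : EuclideanSpace ℝ (Fin N) → ℝ}
    {F F' : EuclideanSpace ℝ (Fin N) → EuclideanSpace ℝ (Fin N)} (h : IsGenGradient Ω u F)
    (h' : IsGenGradient Ω u F') : F =ᵐ[volume.restrict Ω] F' := by
  have key : ∀ n : ℕ, Set.indicator {x | |u x| ≤ (n : ℝ) + 1} F =ᵐ[volume.restrict Ω]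
      Set.indicator {x | |u x| ≤ (n : ℝ) + 1} F' := fun n =>
    (h.2 _ (by positivity)).2.2.1.ae_eq hΩ (h'.2 _ (by positivity)).2.2.1 EventuallyEq.rfl
  filter_upwards [ae_all_iff.2 key] with x hx
  obtain ⟨n, hn⟩ := exists_nat_ge |u x|
  have hm : x ∈ {x | |u x| ≤ (n : ℝ) + 1} := by
    simp only [Set.mem_ofPred_eq]
    linarith
  simpa [Set.indicator_of_mem hm] using hx n

/-- A function all of whose truncations are in `H¹₀` has a generalized gradient. -/
theorem exists_isGenGradient [IsFiniteMeasure (volume.restrict Ω)] (hΩ : IsOpen Ω)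
    {u : EuclideanSpace ℝ (Fin N) → ℝ}
    (hu : ∀ k : ℝ, 0 < k → MemH10 Ω (fun x => trunc k (u x))) : ∃ F, IsGenGradient Ω u F := by
  choose! G hG using hu
  -- This comes from T_k ∘ T_m = T_k. The inequality is strict because |T_m(s)| ≤ m holds for every
  -- s, so for k = m the set {|T_m(u)| ≤ k} is not {|u| ≤ k}.
  have compat : ∀ k m : ℝ, 0 < k → k < m →
      Set.indicator {x | |u x| ≤ k} (G m) =ᵐ[volume.restrict Ω] G k := by
    intro k m hk hkm
    have h1 := (hG m (hk.trans hkm)).trunc hk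
    simp only [abs_trunc_le_iff hk.le hkm, trunc_trunc hk.le hkm.le] at h1
    exact h1.2.2.1.ae_eq hΩ (hG k hk).2.2.1 EventuallyEq.rfl
  have hcompat : ∀ k : ℝ, 0 < k → ∀ᵐ x ∂volume.restrict Ω, ∀ n : ℕ, k < n → |u x| ≤ k →
      G n x = G k x := by
    intro k hk
    refine ae_all_iff.2 fun n => ?_
    by_cases hkn : k < n
    · filter_upwards [compat k n hk hkn] with x hx _ hux
      rwa [Set.indicator_of_mem (by exact hux)] at hx
    · exact Eventually.of_forall fun x h => absurd h hkn
  have hconst : ∀ᵐ x ∂volume.restrict Ω, ∀ n : ℕ, |u x| ≤ n + 1 → ∀ l : ℕ, n + 1 < l →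
      G l x = G (n + 1 : ℕ) x := by
    refine ae_all_iff.2 fun n => ?_
    filter_upwards [hcompat (n + 1 : ℕ) (by positivity)] with x hx hux l hl
    exact hx l (by exact_mod_cast hl) (by push_cast; exact hux)
  have hlim : ∀ᵐ x ∂volume.restrict Ω, ∃ y, Tendsto (fun n : ℕ => G n x) atTop (𝓝 y) := by
    filter_upwards [hconst] with x hx
    obtain ⟨n, hn⟩ := exists_nat_ge |u x|
    refine ⟨G (n + 1 : ℕ) x, tendsto_const_nhds.congr' ?_⟩
    filter_upwards [eventually_gt_atTop (n + 1)] with l hl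
    exact (hx n (by linarith) l hl).symm
  let ψ : EuclideanSpace ℝ (Fin N) → EuclideanSpace ℝ (Fin N) := fun x =>
    limUnder atTop fun n : ℕ => G (n + 1 : ℕ) x
  have hψ : ∀ᵐ x ∂volume.restrict Ω, Tendsto (fun n : ℕ => G (n + 1 : ℕ) x) atTop (𝓝 (ψ x)) := by
    filter_upwards [hlim] with x ⟨y, hy⟩
    exact tendsto_nhds_limUnder ⟨y, hy.comp (tendsto_add_atTop_nat 1)⟩
  refine ⟨ψ, aemeasurable_of_tendsto_metrizable_ae atTop
    (fun n : ℕ => (hG (n + 1 : ℕ) (by positivity)).2.1.1.aemeasurable) hψ, fun k hk => ?_⟩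
  refine (hG k hk).congr_ae EventuallyEq.rfl ?_
  -- Any level above k serves: this says that `G k` vanishes a.e. where |u| > k.
  have hzero := compat k (k + 1) hk (by linarith)
  filter_upwards [hψ, hcompat k hk, hzero] with x hx hcx h0
  by_cases hux : |u x| ≤ k
  · rw [Set.indicator_of_mem (by exact hux)]
    refine tendsto_nhds_unique (tendsto_const_nhds.congr' ?_) hx
    obtain ⟨n, hn⟩ := exists_nat_gt k
    filter_upwards [eventually_ge_atTop n] with l hl
    refine (hcx (l + 1) ?_ hux).symm
    have : (n : ℝ) ≤ l := by exact_mod_cast hl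
    push_cast
    linarith
  · rw [Set.indicator_of_notMem (by exact hux)] at h0 ⊢
    exact h0.symm

theorem isGenGradient_genGradient [IsFiniteMeasure (volume.restrict Ω)] (hΩ : IsOpen Ω)
    {u : EuclideanSpace ℝ (Fin N) → ℝ}
    (hu : ∀ k : ℝ, 0 < k → MemH10 Ω (fun x => trunc k (u x))) :
    IsGenGradient Ω u (genGradient Ω u) := by
  have h := exists_isGenGradient hΩ hu
  rw [genGradient, dif_pos h]
  exact h.choose_spec

/-! ### Measurability of superpositions -/

/-- A Carathéodory function composed with an almost everywhere measurable function is almost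
everywhere measurable. -/
theorem aemeasurable_caratheodory_comp {X Y : Type*} [MeasurableSpace X] {m : Measure X}
    [TopologicalSpace Y] [TopologicalSpace.PseudoMetrizableSpace Y] [SecondCountableTopology Y]
    [MeasurableSpace Y] [BorelSpace Y] {f : X → Y → ℝ}
    (hf : ∀ y, AEMeasurable (fun x => f x y) m) (hc : ∀ᵐ x ∂m, Continuous (f x))
    {q : X → Y} (hq : AEMeasurable q m) : AEMeasurable (fun x => f x (q x)) m := by
  have hs := hq.aestronglyMeasurable
  let s : ℕ → SimpleFunc X Y := hs.stronglyMeasurable_mk.approx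
  have hsf : ∀ n, AEMeasurable (fun x => f x (s n x)) m := by
    intro n
    -- On each fibre of the simple function the second argument is frozen, so measurability at fixed
    -- y suffices.
    have e : (fun x => f x (s n x)) =
        fun x => ∑ y ∈ (s n).range, (s n ⁻¹' {y}).indicator (fun x => f x y) x := by
      ext x
      rw [Finset.sum_eq_single (s n x)]
      · simp
      · intro y _ hy
        exact Set.indicator_of_notMem (fun h => hy h.symm) _
      · intro h
        exact absurd (SimpleFunc.mem_range_self _ _) h
    rw [e]
    exact Finset.aemeasurable_fun_sum _ fun y _ => (hf y).indicator ((s n).measurableSet_fiber y)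
  refine aemeasurable_of_tendsto_metrizable_ae atTop hsf ?_
  filter_upwards [hs.ae_eq_mk, hc] with x hx hcx
  rw [hx]
  exact (hcx.tendsto _).comp (hs.stronglyMeasurable_mk.tendsto_approx x)

/-- A directional derivative of j is a limit of difference quotients, hence measurable in x, and it
is continuous in (s,ξ) since j is C¹. It is therefore itself a Carathéodory function. -/
theorem IsAdmissibleIntegrand.aemeasurable_fderiv_comp {α γ μ : ℝ → ℝ}
    {j : EuclideanSpace ℝ (Fin N) → ℝ → EuclideanSpace ℝ (Fin N) → ℝ}
    (hj : IsAdmissibleIntegrand Ω α γ μ j)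
    {q : EuclideanSpace ℝ (Fin N) → ℝ × EuclideanSpace ℝ (Fin N)}
    (hq : AEMeasurable q (volume.restrict Ω)) (d : ℝ × EuclideanSpace ℝ (Fin N)) :
    AEMeasurable (fun x => fderiv ℝ (fun p : ℝ × EuclideanSpace ℝ (Fin N) => j x p.1 p.2) (q x) d)
      (volume.restrict Ω) := by
  refine aemeasurable_caratheodory_comp (f := fun x p =>
    fderiv ℝ (fun p : ℝ × EuclideanSpace ℝ (Fin N) => j x p.1 p.2) p d) (fun p => ?_) ?_ hq
  · refine aemeasurable_of_tendsto_metrizable_ae atTop (f := fun (n : ℕ) x =>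
      (n : ℝ) * (j x (p + (n : ℝ)⁻¹ • d).1 (p + (n : ℝ)⁻¹ • d).2 - j x p.1 p.2))
      (fun n => ((hj.measurable _ _).sub (hj.measurable _ _)).const_mul _) ?_
    filter_upwards [hj.contDiff] with x hx
    exact ((hx.differentiable one_ne_zero) p).hasFDerivAt.lim d (c := fun n : ℕ => (n : ℝ))
      (by simpa using tendsto_natCast_atTop_atTop)
  · filter_upwards [hj.contDiff] with x hx
    exact (hx.continuous_fderiv one_ne_zero).clm_apply continuous_const

theorem partialS_eq_fderiv {j : EuclideanSpace ℝ (Fin N) → ℝ → EuclideanSpace ℝ (Fin N) → ℝ}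
    {x : EuclideanSpace ℝ (Fin N)}
    (hx : ContDiff ℝ 1 (fun p : ℝ × EuclideanSpace ℝ (Fin N) => j x p.1 p.2)) (s : ℝ)
    (ξ : EuclideanSpace ℝ (Fin N)) :
    partialS j x s ξ =
      fderiv ℝ (fun p : ℝ × EuclideanSpace ℝ (Fin N) => j x p.1 p.2) (s, ξ) (1, 0) := by
  have h := ((hx.differentiable one_ne_zero) (s, ξ)).hasFDerivAt
  have h2 : HasDerivAt (fun t : ℝ => (t, ξ)) (1, 0) s :=
    (hasDerivAt_id s).prodMk (hasDerivAt_const s ξ)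
  exact (h.comp_hasDerivAt s h2).deriv

theorem inner_partialXi_eq_fderiv
    {j : EuclideanSpace ℝ (Fin N) → ℝ → EuclideanSpace ℝ (Fin N) → ℝ}
    {x : EuclideanSpace ℝ (Fin N)}
    (hx : ContDiff ℝ 1 (fun p : ℝ × EuclideanSpace ℝ (Fin N) => j x p.1 p.2)) (s : ℝ)
    (ξ d : EuclideanSpace ℝ (Fin N)) :
    inner ℝ (partialXi j x s ξ) d =
      fderiv ℝ (fun p : ℝ × EuclideanSpace ℝ (Fin N) => j x p.1 p.2) (s, ξ) (0, d) := by
  have h := ((hx.differentiable one_ne_zero) (s, ξ)).hasFDerivAt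
  have h2 : HasFDerivAt (fun η : EuclideanSpace ℝ (Fin N) => (s, η))
      (ContinuousLinearMap.inr ℝ ℝ (EuclideanSpace ℝ (Fin N))) ξ := hasFDerivAt_prodMk_right s ξ
  have h3 := (h.comp ξ h2).fderiv
  rw [real_inner_comm, partialXi, inner_gradient_right]
  have h4 : fderiv ℝ (fun η => j x s η) ξ = _ := h3
  rw [h4]
  simp

theorem IsAdmissibleIntegrand.aemeasurable_partialS {α γ μ : ℝ → ℝ}
    {j : EuclideanSpace ℝ (Fin N) → ℝ → EuclideanSpace ℝ (Fin N) → ℝ}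
    (hj : IsAdmissibleIntegrand Ω α γ μ j) {u : EuclideanSpace ℝ (Fin N) → ℝ}
    {F : EuclideanSpace ℝ (Fin N) → EuclideanSpace ℝ (Fin N)}
    (hu : AEMeasurable u (volume.restrict Ω)) (hF : AEMeasurable F (volume.restrict Ω)) :
    AEMeasurable (fun x => partialS j x (u x) (F x)) (volume.restrict Ω) := by
  refine (hj.aemeasurable_fderiv_comp (hu.prodMk hF) (1, 0)).congr ?_
  filter_upwards [hj.contDiff] with x hx
  exact (partialS_eq_fderiv hx _ _).symm

theorem IsAdmissibleIntegrand.aemeasurable_partialXi {α γ μ : ℝ → ℝ}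
    {j : EuclideanSpace ℝ (Fin N) → ℝ → EuclideanSpace ℝ (Fin N) → ℝ}
    (hj : IsAdmissibleIntegrand Ω α γ μ j) {u : EuclideanSpace ℝ (Fin N) → ℝ}
    {F : EuclideanSpace ℝ (Fin N) → EuclideanSpace ℝ (Fin N)}
    (hu : AEMeasurable u (volume.restrict Ω)) (hF : AEMeasurable F (volume.restrict Ω)) :
    AEMeasurable (fun x => partialXi j x (u x) (F x)) (volume.restrict Ω) := by
  let b := EuclideanSpace.basisFun (Fin N) ℝ
  have h : AEMeasurable (fun x => ∑ i, (fderiv ℝ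
      (fun p : ℝ × EuclideanSpace ℝ (Fin N) => j x p.1 p.2) (u x, F x) (0, b i)) • b i)
      (volume.restrict Ω) :=
    Finset.aemeasurable_fun_sum _ fun i _ =>
      (hj.aemeasurable_fderiv_comp (hu.prodMk hF) (0, b i)).smul_const (b i)
  refine h.congr ?_
  filter_upwards [hj.contDiff] with x hx
  simp only [← inner_partialXi_eq_fderiv hx]
  conv_rhs => rw [← b.sum_repr' (partialXi j x (u x) (F x))]
  simp only [real_inner_comm]

/-! ### Derivatives of the transformed integrand -/

theorem partialXi_sharpJ {j : EuclideanSpace ℝ (Fin N) → ℝ → EuclideanSpace ℝ (Fin N) → ℝ}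
    {x : EuclideanSpace ℝ (Fin N)}
    (hx : ContDiff ℝ 1 (fun p : ℝ × EuclideanSpace ℝ (Fin N) => j x p.1 p.2)) (φ : ℝ → ℝ) (s : ℝ)
    (ξ : EuclideanSpace ℝ (Fin N)) :
    partialXi (sharpJ φ j) x s ξ =
      deriv φ s • partialXi j x (φ s) (deriv φ s • ξ) := by
  have h := ((hx.differentiable one_ne_zero) (φ s, deriv φ s • ξ)).hasFDerivAt
  have h2 : HasFDerivAt (fun η : EuclideanSpace ℝ (Fin N) => (φ s, deriv φ s • η))
      ((0 : EuclideanSpace ℝ (Fin N) →L[ℝ] ℝ).prod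
        (deriv φ s • ContinuousLinearMap.id ℝ (EuclideanSpace ℝ (Fin N)))) ξ :=
    (hasFDerivAt_const _ _).prodMk ((hasFDerivAt_id ξ).fun_const_smul _)
  have h4 := (h.comp ξ h2).fderiv
  change fderiv ℝ (fun η => sharpJ φ j x s η) ξ = _ at h4
  refine ext_inner_right ℝ fun d => ?_
  rw [inner_smul_left, inner_partialXi_eq_fderiv hx, real_inner_comm, partialXi,
    inner_gradient_right, h4]
  have : ((0 : ℝ), deriv φ s • d) = deriv φ s • ((0 : ℝ), d) := by simp
  change fderiv ℝ (fun p : ℝ × EuclideanSpace ℝ (Fin N) => j x p.1 p.2) _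
    ((0 : ℝ), deriv φ s • d) = _
  rw [this, map_smul]
  simp

theorem partialS_sharpJ {j : EuclideanSpace ℝ (Fin N) → ℝ → EuclideanSpace ℝ (Fin N) → ℝ}
    {x : EuclideanSpace ℝ (Fin N)}
    (hx : ContDiff ℝ 1 (fun p : ℝ × EuclideanSpace ℝ (Fin N) => j x p.1 p.2)) {φ : ℝ → ℝ}
    (hφ : ContDiff ℝ 2 φ) (s : ℝ) (ξ : EuclideanSpace ℝ (Fin N)) :
    partialS (sharpJ φ j) x s ξ =
      deriv φ s * partialS j x (φ s) (deriv φ s • ξ) +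
        deriv (deriv φ) s * inner ℝ (partialXi j x (φ s) (deriv φ s • ξ)) ξ := by
  have h := ((hx.differentiable one_ne_zero) (φ s, deriv φ s • ξ)).hasFDerivAt
  have hd : HasDerivAt φ (deriv φ s) s := (hφ.differentiable two_ne_zero s).hasDerivAt
  have hdd : HasDerivAt (deriv φ) (deriv (deriv φ) s) s := by
    have h1 : ContDiff ℝ (1 + 1) φ := by simpa [one_add_one_eq_two] using hφ
    exact ((contDiff_succ_iff_deriv.1 h1).2.2.differentiable one_ne_zero s).hasDerivAt
  have h2 : HasDerivAt (fun t => (φ t, deriv φ t • ξ)) (deriv φ s, deriv (deriv φ) s • ξ) s :=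
    hd.prodMk (hdd.smul_const ξ)
  have h4 := (h.comp_hasDerivAt s h2).deriv
  change partialS (sharpJ φ j) x s ξ = _ at h4
  rw [h4, partialS_eq_fderiv hx, inner_partialXi_eq_fderiv hx]
  have e : (deriv φ s, deriv (deriv φ) s • ξ) =
      deriv φ s • ((1 : ℝ), (0 : EuclideanSpace ℝ (Fin N))) +
        deriv (deriv φ) s • ((0 : ℝ), ξ) := by simp
  rw [e, map_add, map_smul, map_smul, smul_eq_mul, smul_eq_mul]

/-! ### The change of variable -/

theorem IsAdmissibleDiffeo.contDiff {α φ : ℝ → ℝ} (hφ : IsAdmissibleDiffeo α φ) :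
    ContDiff ℝ 2 φ := by
  obtain ⟨Φ, rfl⟩ := hφ.diffeo
  exact Φ.contMDiff_toFun.contDiff

theorem IsAdmissibleDiffeo.surjective {α φ : ℝ → ℝ} (hφ : IsAdmissibleDiffeo α φ) :
    Function.Surjective φ := by
  obtain ⟨Φ, rfl⟩ := hφ.diffeo
  exact Φ.surjective

theorem IsAdmissibleDiffeo.contDiff_deriv {α φ : ℝ → ℝ} (hφ : IsAdmissibleDiffeo α φ) :
    ContDiff ℝ 1 (deriv φ) := by
  have h1 : ContDiff ℝ (1 + 1) φ := by simpa [one_add_one_eq_two] using hφ.contDiff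
  exact (contDiff_succ_iff_deriv.1 h1).2.2

theorem IsAdmissibleDiffeo.exists_le_deriv {α φ : ℝ → ℝ} (hφ : IsAdmissibleDiffeo α φ)
    (hα : ∀ r, 0 ≤ r → 1 ≤ α r) : ∃ σ : ℝ, 0 < σ ∧ ∀ s, σ ≤ deriv φ s := by
  obtain ⟨σ, hσ, h⟩ := hφ.lower_bound
  refine ⟨σ, hσ, fun s => le_trans ?_ (h s)⟩
  exact le_mul_of_one_le_right hσ.le (Real.one_le_sqrt.2 (hα _ (abs_nonneg _)))

theorem IsAdmissibleDiffeo.deriv_pos {α φ : ℝ → ℝ} (hφ : IsAdmissibleDiffeo α φ)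
    (hα : ∀ r, 0 ≤ r → 1 ≤ α r) (s : ℝ) : 0 < deriv φ s := by
  obtain ⟨σ, hσ, h⟩ := hφ.exists_le_deriv hα
  exact hσ.trans_le (h s)

theorem IsAdmissibleDiffeo.strictMono {α φ : ℝ → ℝ} (hφ : IsAdmissibleDiffeo α φ)
    (hα : ∀ r, 0 ≤ r → 1 ≤ α r) : StrictMono φ :=
  strictMono_of_deriv_pos (hφ.deriv_pos hα)

theorem IsAdmissibleDiffeo.exists_pos_eq {α φ : ℝ → ℝ} (hφ : IsAdmissibleDiffeo α φ)
    (hα : ∀ r, 0 ≤ r → 1 ≤ α r) {k : ℝ} (hk : 0 < k) : ∃ m, 0 < m ∧ φ m = k := by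
  obtain ⟨m, rfl⟩ := hφ.surjective k
  refine ⟨m, (hφ.strictMono hα).lt_iff_lt.1 ?_, rfl⟩
  rwa [hφ.map_zero]

theorem IsAdmissibleDiffeo.trunc_map {α φ : ℝ → ℝ} (hφ : IsAdmissibleDiffeo α φ)
    (hα : ∀ r, 0 ≤ r → 1 ≤ α r) (m s : ℝ) : trunc (φ m) (φ s) = φ (trunc m s) := by
  have h := (hφ.strictMono hα).monotone
  rw [trunc, trunc, h.map_max, h.map_min, hφ.odd]

theorem IsAdmissibleDiffeo.abs_map_le_iff {α φ : ℝ → ℝ} (hφ : IsAdmissibleDiffeo α φ)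
    (hα : ∀ r, 0 ≤ r → 1 ≤ α r) (m s : ℝ) : |φ s| ≤ φ m ↔ |s| ≤ m := by
  rw [abs_le, abs_le, ← hφ.odd, (hφ.strictMono hα).le_iff_le, (hφ.strictMono hα).le_iff_le]

theorem IsAdmissibleDiffeo.deriv_neg {α φ : ℝ → ℝ} (hφ : IsAdmissibleDiffeo α φ) (s : ℝ) :
    deriv φ (-s) = deriv φ s := by
  have h : (fun t => φ (-t)) = fun t => -φ t := funext hφ.odd
  have h2 := deriv_comp_neg φ s
  rw [h, deriv.fun_neg] at h2
  linarith

theorem IsAdmissibleDiffeo.deriv_deriv_neg {α φ : ℝ → ℝ} (hφ : IsAdmissibleDiffeo α φ) (s : ℝ) :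
    deriv (deriv φ) (-s) = -deriv (deriv φ) s := by
  have h2 := deriv_comp_neg (deriv φ) s
  simp only [hφ.deriv_neg] at h2
  linarith

/-- The quotient is continuous with a finite limit at +∞, and it is even because φ' is even and φ''
odd. -/
theorem IsAdmissibleDiffeo.exists_abs_mul_deriv_deriv_div_le {α φ : ℝ → ℝ}
    (hφ : IsAdmissibleDiffeo α φ) (hα : ∀ r, 0 ≤ r → 1 ≤ α r) :
    ∃ C, ∀ s, |s * deriv (deriv φ) s / deriv φ s| ≤ C := by
  obtain ⟨β, -, -, -, h⟩ := hφ.asymptotic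
  have hc : Continuous fun s => s * deriv (deriv φ) s / deriv φ s :=
    (continuous_id.mul (hφ.contDiff_deriv.continuous_deriv le_rfl)).div₀
      hφ.contDiff_deriv.continuous fun s => (hφ.deriv_pos hα s).ne'
  have h' : Tendsto (fun s => |s * deriv (deriv φ) s / deriv φ s|) atTop
      (𝓝 |1 / (1 - β) - 1|) := by
    simpa using (h.sub_const 1).abs
  obtain ⟨R, hR⟩ := eventually_atTop.1 (h'.eventually_le_const (lt_add_one _))
  obtain ⟨C, hC⟩ := isCompact_Icc.exists_bound_of_continuousOn (s := Set.Icc 0 R) hc.continuousOn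
  have pos : ∀ s, 0 ≤ s → |s * deriv (deriv φ) s / deriv φ s| ≤
      max C (|1 / (1 - β) - 1| + 1) := by
    intro s hs
    rcases le_total s R with h | h
    · exact (hC s ⟨hs, h⟩).trans (le_max_left _ _)
    · exact (hR s h).trans (le_max_right _ _)
  refine ⟨max C (|1 / (1 - β) - 1| + 1), fun s => ?_⟩
  rcases le_total 0 s with h | h
  · exact pos s h
  · simpa [hφ.deriv_neg, hφ.deriv_deriv_neg] using pos (-s) (by linarith)

/-- For large s, sφ'/φ exceeds half of its positive limit. On a bounded interval φ(s) ≤ Ms, while φ'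
≥ σ. Oddness covers negative s. -/
theorem IsAdmissibleDiffeo.exists_abs_le_mul {α φ : ℝ → ℝ} (hφ : IsAdmissibleDiffeo α φ)
    (hα : ∀ r, 0 ≤ r → 1 ≤ α r) : ∃ C, ∀ s, |φ s| ≤ C * |s * deriv φ s| := by
  obtain ⟨β, -, hβ, h, -⟩ := hφ.asymptotic
  obtain ⟨σ, hσ, hσφ⟩ := hφ.exists_le_deriv hα
  have hb : 0 < 1 / (1 - β) := by
    have : 0 < 1 - β := by linarith
    positivity
  obtain ⟨R, hR⟩ := eventually_atTop.1 ((h.eventually_const_le (half_lt_self hb)).and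
    (eventually_gt_atTop 0))
  obtain ⟨M, hM⟩ := isCompact_Icc.exists_bound_of_continuousOn (s := Set.Icc 0 R)
    hφ.contDiff_deriv.continuous.continuousOn
  set c := 1 / (1 - β) / 2 with hc
  have hc0 : 0 < c := by positivity
  have pos : ∀ s, 0 ≤ s → |φ s| ≤ max (M / σ) (1 / c) * |s * deriv φ s| := by
    intro s hs
    have hp : 0 ≤ s * deriv φ s := mul_nonneg hs (hσ.le.trans (hσφ s))
    have hφs : 0 ≤ φ s := by
      rw [← hφ.map_zero]
      exact (hφ.strictMono hα).monotone hs
    rw [abs_of_nonneg hp, abs_of_nonneg hφs]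
    rcases le_total s R with h1 | h1
    · refine le_trans ?_ (mul_le_mul_of_nonneg_right (le_max_left _ _) hp)
      have h2 : ‖φ s - φ 0‖ ≤ M * ‖s - 0‖ :=
        (convex_Icc (0 : ℝ) s).norm_image_sub_le_of_norm_deriv_le
          (fun t _ => hφ.contDiff.differentiable two_ne_zero t)
          (fun t ht => hM t ⟨ht.1, ht.2.trans h1⟩) ⟨le_rfl, hs⟩ ⟨hs, le_rfl⟩
      rw [hφ.map_zero, sub_zero, sub_zero, Real.norm_of_nonneg hφs, Real.norm_of_nonneg hs] at h2
      have hM0 : 0 ≤ M := (norm_nonneg _).trans (hM s ⟨hs, h1⟩)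
      calc φ s ≤ M * s := h2
        _ = M / σ * (s * σ) := by field_simp
        _ ≤ M / σ * (s * deriv φ s) := by gcongr; exact hσφ s
    · refine le_trans ?_ (mul_le_mul_of_nonneg_right (le_max_right _ _) hp)
      obtain ⟨h2, h3⟩ := hR s h1
      have hφs' : 0 < φ s := by
        rw [← hφ.map_zero]
        exact hφ.strictMono hα h3
      rw [le_div_iff₀ hφs'] at h2
      rw [one_div, ← div_eq_inv_mul, le_div_iff₀ hc0]
      linarith
  refine ⟨max (M / σ) (1 / c), fun s => ?_⟩
  rcases le_total 0 s with h | h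
  · exact pos s h
  · simpa [hφ.deriv_neg, hφ.odd, abs_neg] using pos (-s) (by linarith)

/-- The generalized gradient of `φ(v)` is `φ'(v)∇v`. -/
theorem IsGenGradient.comp_diffeo [IsFiniteMeasure (volume.restrict Ω)] {α φ : ℝ → ℝ}
    (hφ : IsAdmissibleDiffeo α φ)
    (hα : ∀ r, 0 ≤ r → 1 ≤ α r) {v : EuclideanSpace ℝ (Fin N) → ℝ}
    {F : EuclideanSpace ℝ (Fin N) → EuclideanSpace ℝ (Fin N)}
    (hv : AEMeasurable v (volume.restrict Ω)) (hF : IsGenGradient Ω v F) :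
    IsGenGradient Ω (fun x => φ (v x)) (fun x => deriv φ (v x) • F x) := by
  refine ⟨(hφ.contDiff_deriv.continuous.measurable.comp_aemeasurable hv).smul hF.1,
    fun k hk => ?_⟩
  -- Levels correspond through k = φ(m): T_k(φ(v)) = φ(T_m(v)), and {|φ(v)| ≤ k} = {|v| ≤ m}.
  obtain ⟨m, hm, rfl⟩ := hφ.exists_pos_eq hα hk
  have h := (hF.2 m hm).comp_of_bounded (m := m)
    (Eventually.of_forall fun x => abs_trunc_le hm.le _)
    (hφ.contDiff.of_le one_le_two) hφ.map_zero
  refine h.congr_ae (Eventually.of_forall fun x => (hφ.trunc_map hα _ _).symm)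
    (Eventually.of_forall fun x => ?_)
  by_cases hx : |v x| ≤ m
  · have hx' := (hφ.abs_map_le_iff hα m (v x)).2 hx
    simp [hx, hx', trunc_of_abs_le hx]
  · have hx' := (hφ.abs_map_le_iff hα m (v x)).not.2 hx
    simp [hx, hx']

/-! ### Transformation of solutions -/

theorem MemLinfty.exists_bound {u : EuclideanSpace ℝ (Fin N) → ℝ} (hu : MemLinfty Ω u) :
    ∃ M, 0 < M ∧ ∀ᵐ x ∂volume.restrict Ω, |u x| ≤ M := by
  have hfin : eLpNormEssSup u (volume.restrict Ω) ≠ ⊤ := by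
    simpa using hu.2.ne
  refine ⟨(eLpNormEssSup u (volume.restrict Ω)).toReal + 1, by positivity, ?_⟩
  filter_upwards [ae_le_eLpNormEssSup (f := u) (μ := volume.restrict Ω)] with x hx
  have := ENNReal.toReal_mono hfin hx
  rw [toReal_enorm, Real.norm_eq_abs] at this
  linarith

/-- The test function `w / φ'(v)` used to transform the equation. -/
theorem MemH10With.div_deriv [IsFiniteMeasure (volume.restrict Ω)] (hΩ : IsOpen Ω)
    {α φ : ℝ → ℝ} (hφ : IsAdmissibleDiffeo α φ) (hα : ∀ r, 0 ≤ r → 1 ≤ α r)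
    {v w : EuclideanSpace ℝ (Fin N) → ℝ}
    {F G : EuclideanSpace ℝ (Fin N) → EuclideanSpace ℝ (Fin N)} (hF : IsGenGradient Ω v F)
    (hw : MemH10With Ω w G) {M m : ℝ} (hm : 0 < m) (hwM : ∀ᵐ x ∂volume.restrict Ω, |w x| ≤ M)
    (hvm : ∀ᵐ x ∂volume.restrict Ω, w x ≠ 0 → |v x| ≤ m) :
    MemH10With Ω (fun x => w x / deriv φ (v x)) (fun x => (deriv φ (v x))⁻¹ • G x -
      (w x * deriv (deriv φ) (v x) / deriv φ (v x) ^ 2) • F x) := by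
  have hpos := hφ.deriv_pos hα
  -- The chain rule in H¹₀ needs a function vanishing at 0, so 1/φ' is shifted by its value there;
  -- the missing term cw is added back after the product rule.
  set c := (deriv φ 0)⁻¹ with hc
  have hf : ContDiff ℝ 1 fun t => (deriv φ t)⁻¹ - c :=
    (hφ.contDiff_deriv.inv fun t => (hpos t).ne').sub contDiff_const
  have hd : ∀ t, deriv (fun t => (deriv φ t)⁻¹ - c) t =
      -deriv (deriv φ) t / deriv φ t ^ 2 := fun t =>
    ((((hφ.contDiff_deriv.differentiable one_ne_zero t).hasDerivAt).inv
      (hpos t).ne').sub_const c).deriv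
  obtain ⟨K, hK⟩ := isCompact_Icc.exists_bound_of_continuousOn (s := Set.Icc (-m) m)
    hf.continuous.continuousOn
  have hz := (hF.2 m hm).comp_of_bounded (m := m)
    (Eventually.of_forall fun x => abs_trunc_le hm.le _) hf (sub_self _)
  have hprod := (hw.mul_of_bounded hz (m := max M K)
    (hwM.mono fun x hx => hx.trans (le_max_left _ _))
    (Eventually.of_forall fun x => (hK _ (abs_le.1 (abs_trunc_le hm.le _))).trans
      (le_max_right _ _))).add (hw.const_smul c)
  refine hprod.congr_ae ?_ ?_
  · filter_upwards [hvm] with x hx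
    by_cases h0 : w x = 0
    · simp [h0]
    · rw [trunc_of_abs_le (hx h0), div_eq_mul_inv]
      ring
  · filter_upwards [hvm, hw.ae_gradient_eq_zero hΩ] with x hx hGx
    by_cases h0 : w x = 0
    · simp [h0, hGx h0]
    · rw [Set.indicator_of_mem (by exact hx h0), trunc_of_abs_le (hx h0), hd]
      module

/-- The growth coefficients are merely continuous in v, hence bounded only on {|v| ≤ m}; it is
enough that f vanishes elsewhere. -/
theorem integrable_of_norm_le_continuous_mul {X E : Type*} [MeasurableSpace X]
    [NormedAddCommGroup E] {ν : Measure X} {v b : X → ℝ} {f : X → E} {K : ℝ → ℝ} {m : ℝ}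
    (hK : Continuous K) (hb : Integrable b ν) (hb0 : ∀ x, 0 ≤ b x)
    (hf : AEStronglyMeasurable f ν) (hf0 : ∀ᵐ x ∂ν, f x ≠ 0 → |v x| ≤ m)
    (hfb : ∀ᵐ x ∂ν, |v x| ≤ m → ‖f x‖ ≤ K (v x) * b x) : Integrable f ν := by
  obtain ⟨C, hC⟩ := isCompact_Icc.exists_bound_of_continuousOn (s := Set.Icc (-m) m)
    hK.continuousOn
  refine (hb.const_mul |C|).mono' hf ?_
  filter_upwards [hf0, hfb] with x h0 h1
  by_cases hx : f x = 0
  · rw [hx, norm_zero]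
    exact mul_nonneg (abs_nonneg _) (hb0 x)
  · refine (h1 (h0 hx)).trans (mul_le_mul_of_nonneg_right ?_ (hb0 x))
    exact (le_abs_self _).trans ((hC _ (abs_le.1 (h0 hx))).trans (le_abs_self _))

theorem continuous_comp_abs {μ φ : ℝ → ℝ} (hμ : ContinuousOn μ (Set.Ici 0)) (hφ : Continuous φ) :
    Continuous fun s => μ |φ s| :=
  hμ.comp_continuous hφ.abs fun _ => Set.mem_Ici.2 (abs_nonneg _)

/-- The weak formulation transforms under `u = φ(v)`. -/
theorem IsGeneralizedSolution.identity_of_sharp [IsFiniteMeasure (volume.restrict Ω)]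
    (hΩ : IsOpen Ω) {α γ μ φ : ℝ → ℝ}
    {j : EuclideanSpace ℝ (Fin N) → ℝ → EuclideanSpace ℝ (Fin N) → ℝ}
    (hj : IsAdmissibleIntegrand Ω α γ μ j) {g : EuclideanSpace ℝ (Fin N) → ℝ → ℝ}
    (hφ : IsAdmissibleDiffeo α φ) {v : EuclideanSpace ℝ (Fin N) → ℝ}
    (hv : IsGeneralizedSolution Ω (sharpJ φ j) (sharpG φ g) v)
    {F : EuclideanSpace ℝ (Fin N) → EuclideanSpace ℝ (Fin N)}
    (hF : IsGenGradient Ω v F) (hFv : genGradient Ω v = F)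
    {w : EuclideanSpace ℝ (Fin N) → ℝ}
    {G : EuclideanSpace ℝ (Fin N) → EuclideanSpace ℝ (Fin N)}
    (hw : MemV Ω (fun x => φ (v x)) w) (hG : HasWeakGradient Ω w G) :
    (∫ x in Ω, inner ℝ (partialXi j x (φ (v x)) (deriv φ (v x) • F x)) (G x)) +
      (∫ x in Ω, partialS j x (φ (v x)) (deriv φ (v x) • F x) * w x) =
      ∫ x in Ω, g x (φ (v x)) * w x := by
  have hα := hj.one_le_α
  have hpos := hφ.deriv_pos hα
  obtain ⟨⟨G₀, hG₀⟩, hwinf, C, hC⟩ := hw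
  have hwG : MemH10With Ω w G :=
    hG₀.congr_ae EventuallyEq.rfl (hG₀.2.2.1.ae_eq hΩ hG EventuallyEq.rfl)
  obtain ⟨M, hM, hwM⟩ := hwinf.exists_bound
  obtain ⟨m, hm, hmC⟩ := hφ.exists_pos_eq hα (k := max C 1) (by positivity)
  have hvm : ∀ᵐ x ∂volume.restrict Ω, w x ≠ 0 → |v x| ≤ m := by
    filter_upwards [hC] with x hx h0
    rw [← hφ.abs_map_le_iff hα, hmC]
    exact (hx h0).trans (le_max_left _ _)
  have hw' := hwG.div_deriv hΩ hφ hα hF hm hwM hvm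
  obtain ⟨σ, hσ, hσφ⟩ := hφ.exists_le_deriv hα
  have hV : MemV Ω v fun x => w x / deriv φ (v x) := by
    refine ⟨⟨_, hw'⟩, ?_, m, ?_⟩
    · refine memLp_top_of_bound hw'.1.1 (M / σ) ?_
      filter_upwards [hwM] with x hx
      rw [norm_div, Real.norm_eq_abs, Real.norm_of_nonneg (hpos _).le]
      gcongr
      exact hσφ _
    · filter_upwards [hvm] with x hx h0
      exact hx fun h => h0 (by simp [h])
  have hid := hv.identity _ _ hV hw'.2.2.1
  rw [hFv] at hid
  -- F need not be in L², but its restriction to {|v| ≤ m} is ∇T_m(v), and the integrands live on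
  -- that set.
  set H := Set.indicator {x | |v x| ≤ m} F with hH
  have hH2 : MemLp H 2 (volume.restrict Ω) := (hF.2 m hm).2.1
  have hHF : ∀ x, |v x| ≤ m → H x = F x := fun x hx => Set.indicator_of_mem (by exact hx) _
  have hvmeas := hv.measurable
  have humeas : AEMeasurable (fun x => φ (v x)) (volume.restrict Ω) :=
    hφ.contDiff.continuous.measurable.comp_aemeasurable hvmeas
  have hdmeas : AEMeasurable (fun x => deriv φ (v x)) (volume.restrict Ω) :=
    hφ.contDiff_deriv.continuous.measurable.comp_aemeasurable hvmeas
  have hddc : Continuous (deriv (deriv φ)) := hφ.contDiff_deriv.continuous_deriv le_rfl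
  have hddmeas : AEMeasurable (fun x => deriv (deriv φ) (v x)) (volume.restrict Ω) :=
    hddc.measurable.comp_aemeasurable hvmeas
  have hgmeas : AEMeasurable (fun x => deriv φ (v x) • F x) (volume.restrict Ω) :=
    hdmeas.smul hF.1
  have hXi := hj.aemeasurable_partialXi humeas hgmeas
  have hS := hj.aemeasurable_partialS humeas hgmeas
  have hμc := continuous_comp_abs hj.continuousOn_μ hφ.contDiff.continuous
  have hγc := continuous_comp_abs hj.continuousOn_γ hφ.contDiff.continuous
  have hdc := hφ.contDiff_deriv.continuous
  have iA : Integrable (fun x => inner ℝ (partialXi j x (φ (v x)) (deriv φ (v x) • F x)) (G x))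
      (volume.restrict Ω) := by
    refine integrable_of_norm_le_continuous_mul (m := m) (v := v)
      (K := fun s => μ |φ s| * deriv φ s) (b := fun x => ‖H x‖ * ‖G x‖) (hμc.mul hdc)
      (hH2.norm.integrable_mul hwG.2.1.norm) (fun x => by positivity)
      (hXi.inner hwG.2.1.1.aemeasurable).aestronglyMeasurable ?_ ?_
    · filter_upwards [hvm, hwG.ae_gradient_eq_zero hΩ] with x h1 h2 h3
      exact h1 fun h => h3 (by simp [h2 h])
    · filter_upwards [hj.growth_xi] with x hx hvx
      rw [hHF x hvx]
      refine (norm_inner_le_norm _ _).trans ?_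
      have := hx (φ (v x)) (deriv φ (v x) • F x)
      rw [norm_smul, Real.norm_of_nonneg (hpos _).le] at this
      calc _ ≤ μ |φ (v x)| * (deriv φ (v x) * ‖F x‖) * ‖G x‖ := by gcongr
        _ = _ := by ring
  -- This is the term that enters `e1` and `e2` with opposite signs; its integrability permits
  -- splitting the integrals and cancelling it.
  have iR : Integrable (fun x => deriv (deriv φ) (v x) / deriv φ (v x) *
      inner ℝ (partialXi j x (φ (v x)) (deriv φ (v x) • F x)) (F x) * w x)
      (volume.restrict Ω) := by
    refine integrable_of_norm_le_continuous_mul (m := m) (v := v)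
      (K := fun s => |deriv (deriv φ) s| * μ |φ s| * M) (b := fun x => ‖H x‖ * ‖H x‖)
      ((hddc.abs.mul hμc).mul continuous_const)
      (hH2.norm.integrable_mul hH2.norm) (fun x => by positivity)
      (((hddmeas.div hdmeas).mul (hXi.inner hF.1)).mul
        hwG.1.1.aemeasurable).aestronglyMeasurable ?_ ?_
    · filter_upwards [hvm] with x h1 h3
      exact h1 fun h => h3 (by simp [h])
    · filter_upwards [hj.growth_xi, hwM] with x hx hwx hvx
      rw [hHF x hvx, norm_mul, norm_mul, norm_div, Real.norm_of_nonneg (hpos _).le]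
      have h1 := hx (φ (v x)) (deriv φ (v x) • F x)
      rw [norm_smul, Real.norm_of_nonneg (hpos _).le] at h1
      have h2 := (norm_inner_le_norm (𝕜 := ℝ) (partialXi j x (φ (v x)) (deriv φ (v x) • F x))
        (F x)).trans (mul_le_mul_of_nonneg_right h1 (norm_nonneg _))
      have h3 := hpos (v x)
      have h4 := hj.nonneg_μ _ (abs_nonneg (φ (v x)))
      calc _ ≤ ‖deriv (deriv φ) (v x)‖ / deriv φ (v x) *
            (μ |φ (v x)| * (deriv φ (v x) * ‖F x‖) * ‖F x‖) * M := by
            gcongr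
            exact hwx
        _ = _ := by
            rw [Real.norm_eq_abs]
            field_simp
  have iS : Integrable (fun x => partialS j x (φ (v x)) (deriv φ (v x) • F x) * w x)
      (volume.restrict Ω) := by
    refine integrable_of_norm_le_continuous_mul (m := m) (v := v)
      (K := fun s => γ |φ s| * deriv φ s ^ 2 * M) (b := fun x => ‖H x‖ * ‖H x‖)
      ((hγc.mul (hdc.pow 2)).mul continuous_const)
      (hH2.norm.integrable_mul hH2.norm) (fun x => by positivity)
      (hS.mul hwG.1.1.aemeasurable).aestronglyMeasurable ?_ ?_
    · filter_upwards [hvm] with x h1 h3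
      exact h1 fun h => h3 (by simp [h])
    · filter_upwards [hj.growth_s, hwM] with x hx hwx hvx
      rw [hHF x hvx, norm_mul]
      have h1 := hx (φ (v x)) (deriv φ (v x) • F x)
      rw [norm_smul, Real.norm_of_nonneg (hpos _).le] at h1
      have h4 := hj.nonneg_γ _ (abs_nonneg (φ (v x)))
      calc _ ≤ γ |φ (v x)| * (deriv φ (v x) * ‖F x‖) ^ 2 * M := by
            gcongr
            · exact h1
            · exact hwx
        _ = _ := by ring
  have e1 : ∫ x in Ω, inner ℝ (partialXi (sharpJ φ j) x (v x) (F x)) ((deriv φ (v x))⁻¹ • G x -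
      (w x * deriv (deriv φ) (v x) / deriv φ (v x) ^ 2) • F x) =
      (∫ x in Ω, inner ℝ (partialXi j x (φ (v x)) (deriv φ (v x) • F x)) (G x)) -
        ∫ x in Ω, deriv (deriv φ) (v x) / deriv φ (v x) *
          inner ℝ (partialXi j x (φ (v x)) (deriv φ (v x) • F x)) (F x) * w x := by
    rw [← integral_sub iA iR]
    refine integral_congr_ae ?_
    filter_upwards [hj.contDiff] with x hx
    have h3 := (hpos (v x)).ne'
    rw [partialXi_sharpJ hx, inner_sub_right, inner_smul_right, inner_smul_right,
      real_inner_smul_left, real_inner_smul_left]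
    field_simp
  have e2 : ∫ x in Ω, partialS (sharpJ φ j) x (v x) (F x) * (w x / deriv φ (v x)) =
      (∫ x in Ω, partialS j x (φ (v x)) (deriv φ (v x) • F x) * w x) +
        ∫ x in Ω, deriv (deriv φ) (v x) / deriv φ (v x) *
          inner ℝ (partialXi j x (φ (v x)) (deriv φ (v x) • F x)) (F x) * w x := by
    rw [← integral_add iS iR]
    refine integral_congr_ae ?_
    filter_upwards [hj.contDiff] with x hx
    have h3 := (hpos (v x)).ne'
    rw [partialS_sharpJ hx hφ.contDiff]
    field_simp
  have e3 : ∫ x in Ω, sharpG φ g x (v x) * (w x / deriv φ (v x)) =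
      ∫ x in Ω, g x (φ (v x)) * w x := by
    congr 1
    ext x
    have h3 := (hpos (v x)).ne'
    rw [sharpG]
    field_simp
  rw [e1, e2, e3] at hid
  linarith

/-- If `v` is a generalized solution of the transformed problem, `φ(v)` is a generalized solution
of the original one. -/
theorem IsGeneralizedSolution.of_sharp [IsFiniteMeasure (volume.restrict Ω)]
    (hΩ : IsOpen Ω) {α γ μ φ : ℝ → ℝ}
    {j : EuclideanSpace ℝ (Fin N) → ℝ → EuclideanSpace ℝ (Fin N) → ℝ}
    (hj : IsAdmissibleIntegrand Ω α γ μ j) {g : EuclideanSpace ℝ (Fin N) → ℝ → ℝ}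
    (hφ : IsAdmissibleDiffeo α φ) {v : EuclideanSpace ℝ (Fin N) → ℝ}
    (hv : IsGeneralizedSolution Ω (sharpJ φ j) (sharpG φ g) v) :
    IsGeneralizedSolution Ω j g (fun x => φ (v x)) := by
  have hα := hj.one_le_α
  have hpos := hφ.deriv_pos hα
  have hvmeas := hv.measurable
  have humeas : AEMeasurable (fun x => φ (v x)) (volume.restrict Ω) :=
    hφ.contDiff.continuous.measurable.comp_aemeasurable hvmeas
  have hF := isGenGradient_genGradient hΩ hv.truncations
  set F := genGradient Ω v with hFdef
  have hFu := hF.comp_diffeo hφ hα hvmeas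
  have htr : ∀ k : ℝ, 0 < k → MemH10 Ω (fun x => trunc k (φ (v x))) := fun k hk =>
    ⟨_, hFu.2 k hk⟩
  have hgrad : genGradient Ω (fun x => φ (v x)) =ᵐ[volume.restrict Ω]
      fun x => deriv φ (v x) • F x := (isGenGradient_genGradient hΩ htr).ae_eq hΩ hFu
  have iXi : IntegrableOn (fun x => inner ℝ (partialXi j x (φ (v x)) (deriv φ (v x) • F x))
      (deriv φ (v x) • F x)) Ω := by
    refine hv.integrable_xi.congr ?_
    filter_upwards [hj.contDiff] with x hx
    rw [← hFdef, partialXi_sharpJ hx, real_inner_smul_left, real_inner_smul_right]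
  -- Here vφ'(v)j_s equals v j♯_s minus (vφ''(v)/φ'(v)) j_ξ·∇u, a bounded factor times an integrable
  -- function.
  have iS : IntegrableOn (fun x => partialS j x (φ (v x)) (deriv φ (v x) • F x) *
      (v x * deriv φ (v x))) Ω := by
    obtain ⟨C, hC⟩ := hφ.exists_abs_mul_deriv_deriv_div_le hα
    have hc : Continuous fun s => s * deriv (deriv φ) s / deriv φ s :=
      (continuous_id.mul (hφ.contDiff_deriv.continuous_deriv le_rfl)).div₀
        hφ.contDiff_deriv.continuous fun s => (hpos s).ne'
    have h1 := Integrable.bdd_mul (c := C) iXi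
      (hc.measurable.comp_aemeasurable hvmeas).aestronglyMeasurable
      (Eventually.of_forall fun x => hC (v x))
    refine (hv.integrable_s.sub h1).congr ?_
    filter_upwards [hj.contDiff] with x hx
    have h3 := (hpos (v x)).ne'
    simp only [Pi.sub_apply, Function.comp_apply]
    rw [← hFdef, partialS_sharpJ hx hφ.contDiff, real_inner_smul_right]
    field_simp
    ring
  refine ⟨humeas, htr, ?_, ?_, fun w G hw hG => ?_⟩
  · refine iXi.congr ?_
    filter_upwards [hgrad] with x hx
    rw [hx]
  · obtain ⟨C, hC⟩ := hφ.exists_abs_le_mul hα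
    have h1 : IntegrableOn (fun x => partialS j x (φ (v x)) (deriv φ (v x) • F x) * φ (v x)) Ω := by
      refine Integrable.mono' (iS.norm.const_mul C)
        ((hj.aemeasurable_partialS humeas hFu.1).mul humeas).aestronglyMeasurable
        (Eventually.of_forall fun x => ?_)
      rw [norm_mul, norm_mul, mul_left_comm]
      exact mul_le_mul_of_nonneg_left (hC (v x)) (norm_nonneg _)
    refine h1.congr ?_
    filter_upwards [hgrad] with x hx
    rw [hx]
  · rw [← hv.identity_of_sharp hΩ hj hφ hF rfl hw hG]
    congr 1
    · refine integral_congr_ae ?_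
      filter_upwards [hgrad] with x hx
      rw [hx]
    · refine integral_congr_ae ?_
      filter_upwards [hgrad] with x hx
      rw [hx]

/-- A bounded generalized solution is a distributional solution. -/
theorem IsGeneralizedSolution.isDistributionalSolution [IsFiniteMeasure (volume.restrict Ω)]
    (hΩ : IsOpen Ω) {α γ μ : ℝ → ℝ}
    {j : EuclideanSpace ℝ (Fin N) → ℝ → EuclideanSpace ℝ (Fin N) → ℝ}
    (hj : IsAdmissibleIntegrand Ω α γ μ j) {g : EuclideanSpace ℝ (Fin N) → ℝ → ℝ}
    (hg : IsAdmissibleNonlinearity Ω g) {u : EuclideanSpace ℝ (Fin N) → ℝ}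
    (hu : IsGeneralizedSolution Ω j g u) (hinf : MemLinfty Ω u) :
    IsDistributionalSolution Ω j g u := by
  have hF := isGenGradient_genGradient hΩ hu.truncations
  set F := genGradient Ω u with hFdef
  obtain ⟨M, hM, huM⟩ := hinf.exists_bound
  -- Truncating at the essential bound M changes nothing, so the generalized gradient is the weak
  -- one and is in L².
  have huF : MemH10With Ω u F := by
    refine (hF.2 M hM).congr_ae ?_ ?_
    · filter_upwards [huM] with x hx
      exact trunc_of_abs_le hx
    · filter_upwards [huM] with x hx
      exact Set.indicator_of_mem (by exact hx) _
  have hF2 := huF.2.1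
  refine ⟨F, huF.2.2.1, ?_, ?_, ?_, fun ψ hψ => ?_⟩
  · refine IntegrableOn.locallyIntegrableOn (integrable_of_norm_le_continuous_mul (m := M)
      (v := u) (K := fun s => μ |s|) (b := fun x => ‖F x‖)
      (continuous_comp_abs hj.continuousOn_μ continuous_id)
      (hF2.integrable (by norm_num)).norm (fun x => norm_nonneg _)
      (hj.aemeasurable_partialXi hu.measurable hF.1).aestronglyMeasurable
      (huM.mono fun x hx _ => hx) ?_)
    filter_upwards [hj.growth_xi] with x hx _
    exact hx _ _
  · refine IntegrableOn.locallyIntegrableOn (integrable_of_norm_le_continuous_mul (m := M)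
      (v := u) (K := fun s => γ |s|) (b := fun x => ‖F x‖ ^ 2)
      (continuous_comp_abs hj.continuousOn_γ continuous_id)
      hF2.norm.integrable_sq (fun x => by positivity)
      (hj.aemeasurable_partialS hu.measurable hF.1).aestronglyMeasurable
      (huM.mono fun x hx _ => hx) ?_)
    filter_upwards [hj.growth_s] with x hx _
    exact hx _ _
  · refine IntegrableOn.locallyIntegrableOn (Integrable.mono' (hg.integrable_sup M hM.le)
      (aemeasurable_caratheodory_comp hg.measurable hg.continuous
        hu.measurable).aestronglyMeasurable ?_)
    filter_upwards [hg.continuous, huM] with x hx hux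
    -- Continuity of g(x,·) is needed here: a real supremum dominates only when the set is bounded
    -- above.
    exact le_csSup (isCompact_Icc.image hx.abs).bddAbove ⟨u x, abs_le.1 hux, rfl⟩
  · exact hu.identity ψ _ ⟨⟨_, hψ.memH10With⟩, hψ.memLp ⊤, M, huM.mono fun x hx _ => hx⟩
      hψ.memH10With.2.2.1

end QuasiLinear

theorem proposition2p5 {N : ℕ} (Ω : Set (EuclideanSpace ℝ (Fin N)))
    (hΩ_open : IsOpen Ω) (hΩ_bounded : Bornology.IsBounded Ω)
    (α γ μ : ℝ → ℝ)
    (j : EuclideanSpace ℝ (Fin N) → ℝ → EuclideanSpace ℝ (Fin N) → ℝ)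
    (hj : QuasiLinear.IsAdmissibleIntegrand Ω α γ μ j)
    (g : EuclideanSpace ℝ (Fin N) → ℝ → ℝ)
    (hg : QuasiLinear.IsAdmissibleNonlinearity Ω g)
    (φ : ℝ → ℝ) (hφ : QuasiLinear.IsAdmissibleDiffeo α φ)
    (v : EuclideanSpace ℝ (Fin N) → ℝ)
    (hv : QuasiLinear.IsGeneralizedSolution Ω
      (QuasiLinear.sharpJ φ j) (QuasiLinear.sharpG φ g) v) :
    QuasiLinear.IsGeneralizedSolution Ω j g (fun x => φ (v x)) ∧
      (QuasiLinear.MemH10 Ω v → QuasiLinear.MemLinfty Ω v →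
        QuasiLinear.MemH10 Ω (fun x => φ (v x)) ∧
        QuasiLinear.MemLinfty Ω (fun x => φ (v x)) ∧
        QuasiLinear.IsDistributionalSolution Ω j g (fun x => φ (v x))) := by
  have : IsFiniteMeasure (volume.restrict Ω) :=
    isFiniteMeasure_restrict.2 hΩ_bounded.measure_lt_top.ne
  have hsol := hv.of_sharp hΩ_open hj hφ
  refine ⟨hsol, fun ⟨G, hG⟩ hinf => ?_⟩
  obtain ⟨M, -, hvM⟩ := hinf.exists_bound
  have hu := hG.comp_of_bounded hvM (hφ.contDiff.of_le one_le_two) hφ.map_zero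
  have huinf : QuasiLinear.MemLinfty Ω (fun x => φ (v x)) := by
    refine memLp_top_of_bound hu.1.1 (φ M) ?_
    filter_upwards [hvM] with x hx
    exact (hφ.abs_map_le_iff hj.one_le_α M (v x)).2 hx
  exact ⟨⟨_, hu⟩, huinf, hsol.isDistributionalSolution hΩ_open hj hg huinf⟩
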